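/- **Setting.** Let $x=(x_n)_{n\ge1}$, $u=(u_n)_{n\ge1}$, $w$ be variables and consider $\tau=\sum_{s\in\mathbb Z}\tau_s e^{s\alpha}$, where the $\tau_s$ are formal power series over $\mathbb C$ in $x,u,w$ ($e^{kw}$ is read as its exponential series) and the $e^{s\alpha}$ multiply by $e^{p\alpha}e^{q\alpha}=(-1)^{pq}e^{(p+q)\alpha}$ (the twisted group algebra of the root lattice $\mathbb Z\alpha$ of $\mathfrak{sl}_2$). For a polynomial $P$, $P(D)f\circ g$ is the Hirota bilinear expression, where $D_v$ acts on $f\otimes g$ as $\partial_v\otimes1-1\otimes\partial_v$ (followed by multiplication). Put $\tilde D_{x_n}=\frac1nD_{x_n}$, $\tilde D_x=(\tilde D_{x_n})_{n\ge1}$, $D_{x_0}=0$, and define $S_n$ by $\sum_{n\ge0}S_n(c)z^n=\exp(\sum_{j>0}c_jz^j)$, $S_n=0$ for $n<0$. With independent variables $\varepsilon$, $y=(y_n)_{n\ge1}$, $\tilde u=(\tilde u_n)_{n\ge1}$ (and $\tilde u_j=0$ for $j\le0$), the bilinear system for $\tau$ consists of the following equations, for all $m,n\in\mathbb Z$, as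 identities of formal power series in $\varepsilon,y,\tilde u$: $$\begin{aligned} &\Big[(m-n)^2+\sum_{r\ge0}\Big\{2(m-n)D_{x_r}+\sum_{j+k=r;\,j,k>0}D_{x_j}D_{x_k}+2\sum_{k>0}ky_kD_{x_{r+k}}+2\sum_{k>0}(k-r)\tilde u_{k-r}D_{u_k}\Big\}S_r((\varepsilon-D_w)\tilde u)\Big]\,\mathcal E\;\tau_m\circ\tau_n\\ &+(-1)^{m-n}\sum_{r\ge0}\ \sum_{j+k=r;\,j,k\ge0}S_j((\varepsilon-D_w)\tilde u)\,S_k(2y)\,S_{r-2+2m-2n}(-2\tilde D_x)\,\mathcal E\;\tau_{m-1}\circ\tau_{n+1}\\ &+(-1)^{m-n}\sum_{r\ge0}\ \sum_{j+k=r;\,j,k\ge0}S_j((\varepsilon-D_w)\tilde u)\,S_k(-2y)\,S_{r-2-2m+2n}(2\tilde D_x)\,\mathcal E\;\tau_{m+1}\circ\tau_{n-1}=0, \end{aligned}$$ where $\mathcal E=\exp(\sum_{s>0}y_sD_{x_s})\exp(\sum_{s>0}\tilde u_sD_{u_s})$. For $\sigma\in\{\pm1\}$, $k\in\mathbb Z$,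 $z\in\mathbb C^*$ let $$\Gamma_{\sigma;k}(z)=\exp\Big(\sigma\sum_{n>0}x_nz^n\Big)\exp\Big(-2\sigma\sum_{n>0}\tfrac1n z^{-n}\tfrac{\partial}{\partial x_n}\Big)\exp\Big(k\big(w+\sum_{n>0}u_nz^n\big)\Big)e^{\sigma\alpha}z^{\sigma\partial_\alpha},$$ where $z^{\sigma\partial_\alpha}(f\otimes e^{m\alpha})=z^{2\sigma m}f\otimes e^{m\alpha}$ and the exponential of the infinite sum of derivatives is summed coefficientwise, where it converges. **Theorem.** Let $N\ge0$, $\varepsilon_i\in\{\pm1\}$, $a_i\in\mathbb C$, $k_i\in\mathbb Z$ ($1\le i\le N$), and consider $$\tau(z_1,\dots,z_N)=(1+a_N\Gamma_{\varepsilon_N;k_N}(z_N))\cdots(1+a_1\Gamma_{\varepsilon_1;k_1}(z_1)).\,1\otimes1 .$$ 1. If $0<|z_1|<\cdots<|z_N|$, all series in this product converge coefficientwise, and $\tau(z_1,\dots,z_N)$ solves the bilinear system. 2. Each coefficient of $\tau$ extends analytically in $(z_1,\dots,z_N)$ to the set of all $z\in(\mathbb C^*)^N$ with $z_i\ne z_j$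 whenever $\varepsilon_i\neq\varepsilon_j$; for every such $z$, the extended $\tau$ solves the bilinear system. 3. If $\varepsilon_1=\cdots=\varepsilon_N=\sigma$, then for all $z\in(\mathbb C^*)^N$ $$\tau=\sum_{\substack{0\le r\le N\\1\le j_1<\cdots<j_r\le N}}(-1)^{[r/2]}e^{(\sum_\nu k_{j_\nu})w}\prod_{\nu=1}^ra_{j_\nu}\prod_{1\le\nu<\mu\le r}(z_{j_\mu}-z_{j_\nu})^2\exp\Big[\sum_{l>0}\Big\{\sigma\Big(\sum_{\nu=1}^rz_{j_\nu}^l\Big)x_l+\Big(\sum_{\nu=1}^rk_{j_\nu}z_{j_\nu}^l\Big)u_l\Big\}\Big]\otimes e^{\sigma r\alpha}$$ (the product itself for $0<|z_1|<\cdots<|z_N|$, its analytic extension in general). -/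

import Mathlib

noncomputable section

namespace TwoToroidal

open scoped TensorProduct

/-! ### Formal series -/

/-- Sum of a locally finite family of formal power series (each coefficient is a finite sum). -/
def formalSum {ι σ A : Type*} [CommRing A] (f : ι → MvPowerSeries σ A) : MvPowerSeries σ A :=
  fun d => ∑ᶠ i, MvPowerSeries.coeff d (f i)

/-- The formal exponential `exp(f) = ∑ fⁿ / n!` of a series `f` without constant term. -/
def fexp {σ A : Type*} [CommRing A] [Algebra ℂ A] (f : MvPowerSeries σ A) : MvPowerSeries σ A :=
  PowerSeries.subst f (PowerSeries.exp ℂ)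

/-- The elementary Schur polynomial `S_n` evaluated at the sequence `c 1, c 2, …` (the value
`c 0` plays no role): `∑ S_n zⁿ = exp (∑_{j > 0} c j z^j)`, and `S_n = 0` for `n < 0`. -/
def schur {A : Type*} [CommRing A] [Algebra ℂ A] (c : ℕ → A) (n : ℤ) : A :=
  if 0 ≤ n then
    PowerSeries.coeff n.toNat (fexp (PowerSeries.mk fun j => if j = 0 then 0 else c j))
  else 0

/-! ### The space on which the vertex operators act -/

/-- The variables `x_n`, `u_n` (`n ≥ 1`) and `w`. -/
inductive Var : Type
  | x (n : ℕ+)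
  | u (n : ℕ+)
  | w

/-- Formal power series in all `x_n`, `u_n`, `w`. The exponential `e^{kw}` is the
series `∑ (k w)ⁿ / n!`. -/
abbrev Ser : Type := MvPowerSeries Var ℂ

/-- `τ = ∑_s τ_s e^{sα}` is recorded as the family of its components `τ_s`. -/
abbrev Fock : Type := ℤ → Ser

/-- `f ⊗ e^{sα}`. -/
def term (f : Ser) (s : ℤ) : Fock := Pi.single s f

/-- The vector `1 ⊗ 1`. -/
def vac : Fock := term 1 0

/-- The linear form `∑_v c_v v`. -/
def linForm (c : Var → ℂ) : Ser :=
  formalSum fun v => MvPowerSeries.C (c v) * MvPowerSeries.X v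

/-! ### Vertex operators -/

/-- The cocycle of the twisted group algebra of the root lattice `ℤα` of `sl₂`:
`e^{pα} e^{qα} = cocycle p q • e^{(p+q)α}`; it is bimultiplicative and is `-1` at `(α, α)`. -/
def cocycle (p q : ℤ) : ℂ := (-1) ^ (p * q)

/-- Left multiplication by `e^{pα}` in the twisted group algebra. -/
def latticeMul (p : ℤ) (F : Fock) : Fock := fun s => cocycle p (s - p) • F (s - p)

/-- The operator `z^{σ ∂_α}`, acting on `f ⊗ e^{mα}` by `z^{2σm}`. -/
def zPowPartial (σ : ℤ) (z : ℂ) (F : Fock) : Fock := fun m => z ^ (2 * σ * m) • F m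

/-- The `n`-th summand of the derivation `-2σ ∑_{n>0} (1/n) z^{-n} ∂/∂x_n` applied to `f`. -/
def annSummand (σ : ℤ) (z : ℂ) (f : Ser) (n : ℕ+) : Ser :=
  (-2 * (σ : ℂ) * (n : ℂ)⁻¹ * (z ^ (n : ℕ))⁻¹) • MvPowerSeries.pderiv ℂ (Var.x n) f

/-- The derivation `-2σ ∑_{n>0} (1/n) z^{-n} ∂/∂x_n`, the sum being taken coefficientwise. -/
def ann (σ : ℤ) (z : ℂ) (f : Ser) : Ser :=
  fun d => ∑' n : ℕ+, MvPowerSeries.coeff d (annSummand σ z f n)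

/-- `exp (-2σ ∑_{n>0} (1/n) z^{-n} ∂/∂x_n)`, the exponential series being summed
coefficientwise. -/
def expAnn (σ : ℤ) (z : ℂ) (f : Ser) : Ser :=
  fun d => ∑' j : ℕ, ((j.factorial : ℂ)⁻¹) * MvPowerSeries.coeff d ((ann σ z)^[j] f)

/-- All numerical series occurring in `expAnn σ z f` converge. -/
def ExpAnnConverges (σ : ℤ) (z : ℂ) (f : Ser) : Prop :=
  (∀ (j : ℕ) (d : Var →₀ ℕ),
    Summable fun n : ℕ+ => MvPowerSeries.coeff d (annSummand σ z ((ann σ z)^[j] f) n)) ∧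
  ∀ d : Var →₀ ℕ,
    Summable fun j : ℕ => ((j.factorial : ℂ)⁻¹) * MvPowerSeries.coeff d ((ann σ z)^[j] f)

/-- `exp (σ ∑_{n>0} x_n zⁿ)`. -/
def expX (σ : ℤ) (z : ℂ) : Ser :=
  fexp (linForm fun
    | .x n => (σ : ℂ) * z ^ (n : ℕ)
    | .u _ => 0
    | .w => 0)

/-- `exp (k (w + ∑_{n>0} u_n zⁿ))`. -/
def expU (k : ℤ) (z : ℂ) : Ser :=
  fexp (linForm fun
    | .x _ => 0
    | .u n => (k : ℂ) * z ^ (n : ℕ)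
    | .w => (k : ℂ))

/-- The part `exp (k (w + ∑ u_n zⁿ)) e^{σα} z^{σ∂_α}` of the vertex operator. -/
def gammaInner (σ k : ℤ) (z : ℂ) (F : Fock) : Fock :=
  fun s => expU k z * latticeMul σ (zPowPartial σ z F) s

/-- The vertex operator
`Γ_{σ;k}(z) = exp(σ ∑ x_n zⁿ) exp(-2σ ∑ (1/n) z^{-n} ∂/∂x_n) exp(k(w + ∑ u_n zⁿ)) e^{σα} z^{σ∂_α}`
with `σ = ±1`. -/
def Gam (σ : ℤˣ) (k : ℤ) (z : ℂ) (F : Fock) : Fock :=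
  fun s => expX σ z * expAnn σ z (gammaInner σ k z F s)

/-- All numerical series occurring in `Γ_{σ;k}(z) F` converge. -/
def GamConverges (σ : ℤˣ) (k : ℤ) (z : ℂ) (F : Fock) : Prop :=
  ∀ s : ℤ, ExpAnnConverges σ z (gammaInner σ k z F s)

/-- `(1 + a_N Γ_{ε_N;k_N}(z_N)) ⋯ (1 + a_1 Γ_{ε_1;k_1}(z_1)).(1 ⊗ 1)`. -/
def solitonTau : (N : ℕ) → (Fin N → ℤˣ) → (Fin N → ℂ) → (Fin N → ℤ) → (Fin N → ℂ) → Fock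
  | 0, _, _, _, _ => vac
  | N + 1, ε, a, k, z =>
      let F := solitonTau N (fun i => ε i.castSucc) (fun i => a i.castSucc)
        (fun i => k i.castSucc) (fun i => z i.castSucc)
      F + a (Fin.last N) • Gam (ε (Fin.last N)) (k (Fin.last N)) (z (Fin.last N)) F

/-- Every operator in the product defining `solitonTau` is applied to a vector on which it
converges. -/
def SolitonConverges : (N : ℕ) → (Fin N → ℤˣ) → (Fin N → ℂ) → (Fin N → ℤ) → (Fin N → ℂ) → Prop
  | 0, _, _, _, _ => True
  | N + 1, ε, a, k, z =>
      SolitonConverges N (fun i => ε i.castSucc) (fun i => a i.castSucc)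
        (fun i => k i.castSucc) (fun i => z i.castSucc) ∧
      GamConverges (ε (Fin.last N)) (k (Fin.last N)) (z (Fin.last N))
        (solitonTau N (fun i => ε i.castSucc) (fun i => a i.castSucc)
          (fun i => k i.castSucc) (fun i => z i.castSucc))

/-- `0 < |z_1| < ⋯ < |z_N|`. -/
def RadiallyOrdered {N : ℕ} (z : Fin N → ℂ) : Prop :=
  (∀ i, z i ≠ 0) ∧ ∀ i j, i < j → ‖z i‖ < ‖z j‖

/-- Nonzero parameters with `z_i ≠ z_j` whenever the signs `ε_i`, `ε_j` differ. -/
def admissible {N : ℕ} (ε : Fin N → ℤˣ) : Set (Fin N → ℂ) :=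
  {z | (∀ i, z i ≠ 0) ∧ ∀ i j, ε i ≠ ε j → z i ≠ z j}

/-- The closed form for equal signs, as a sum over the subsets `J = {j_1 < ⋯ < j_r}` of the
index set. -/
def closedForm {N : ℕ} (σ : ℤˣ) (a : Fin N → ℂ) (k : Fin N → ℤ) (z : Fin N → ℂ) : Fock :=
  ∑ J : Finset (Fin N),
    term
      (((-1 : ℂ) ^ (J.card / 2) * (∏ j ∈ J, a j) *
          (∏ i ∈ J, ∏ j ∈ J with i < j, (z j - z i) ^ 2)) •
        fexp (linForm fun
          | .x l => ((σ : ℤ) : ℂ) * ∑ j ∈ J, z j ^ (l : ℕ)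
          | .u l => ∑ j ∈ J, (k j : ℂ) * z j ^ (l : ℕ)
          | .w => ∑ j ∈ J, (k j : ℂ)))
      ((σ : ℤ) * J.card)

/-! ### Hirota bilinear operators -/

lemma pderiv_comm (v v' : Var) (f : Ser) :
    MvPowerSeries.pderiv ℂ v (MvPowerSeries.pderiv ℂ v' f) =
      MvPowerSeries.pderiv ℂ v' (MvPowerSeries.pderiv ℂ v f) := by
  classical
  ext d
  by_cases h : v = v'
  · rw [h]
  · simp only [MvPowerSeries.coeff_pderiv, Finsupp.add_apply, Finsupp.single_apply, h,
      Ne.symm h, if_false, add_zero, add_right_comm d]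
    ring

/-- The operator `∂_v ⊗ 1 - 1 ⊗ ∂_v`; following it by multiplication gives the Hirota
derivative `D_v`. -/
def hirotaD (v : Var) : Ser ⊗[ℂ] Ser →ₗ[ℂ] Ser ⊗[ℂ] Ser :=
  (MvPowerSeries.pderiv ℂ v).toLinearMap.rTensor Ser -
    (MvPowerSeries.pderiv ℂ v).toLinearMap.lTensor Ser

lemma hirotaD_comm (v v' : Var) (t : Ser ⊗[ℂ] Ser) :
    hirotaD v (hirotaD v' t) = hirotaD v' (hirotaD v t) := by
  induction t with
  | zero => simp
  | add a b ha hb => simp only [map_add, ha, hb]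
  | tmul f g =>
    simp only [hirotaD, LinearMap.sub_apply, LinearMap.rTensor_tmul, LinearMap.lTensor_tmul,
      map_sub, Derivation.coeFn_coe, pderiv_comm v v']
    abel

instance : LeftCommutative (fun (v : Var) (t : Ser ⊗[ℂ] Ser) => hirotaD v t) :=
  ⟨fun v v' t => hirotaD_comm v v' t⟩

/-- `P(D) f ∘ g` for a polynomial `P` in the Hirota derivatives `D_v`: the monomial
`D_{v_1} ⋯ D_{v_m}` is the composite of the operators `hirotaD`, applied to `f ⊗ g` and
followed by multiplication. -/
def hirotaPoly (P : MvPolynomial Var ℂ) (f g : Ser) : Ser :=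
  LinearMap.mul' ℂ Ser
    (∑ d ∈ P.support, P.coeff d •
      (Finsupp.toMultiset d).foldr (fun v t => hirotaD v t) (f ⊗ₜ[ℂ] g))

/-- The independent variables `y_n`, `ũ_n` (`n ≥ 1`) and `ε`. -/
inductive Par : Type
  | y (n : ℕ+)
  | ut (n : ℕ+)
  | eps

/-- Formal power series in `y_n`, `ũ_n`, `ε` whose coefficients are polynomials in the symbols
`D_{x_n}`, `D_{u_n}`, `D_w`. -/
abbrev Sym : Type := MvPowerSeries Par (MvPolynomial Var ℂ)

/-- `P(D) f ∘ g` for a symbol `P`, coefficient by coefficient in the independent variables. -/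
def hirota (P : Sym) (f g : Ser) : MvPowerSeries Par Ser :=
  fun d => hirotaPoly (MvPowerSeries.coeff d P) f g

/-- `D_{x_n}`, with `D_{x_0} = 0`. -/
def Dx (n : ℕ) : Sym :=
  if h : 0 < n then MvPowerSeries.C (MvPolynomial.X (Var.x ⟨n, h⟩)) else 0

/-- `D_{u_n}`, with `D_{u_0} = 0`. -/
def Du (n : ℕ) : Sym :=
  if h : 0 < n then MvPowerSeries.C (MvPolynomial.X (Var.u ⟨n, h⟩)) else 0

/-- `D_w`. -/
def Dw : Sym := MvPowerSeries.C (MvPolynomial.X Var.w)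

/-- `y_n`, with `y_0 = 0`. -/
def y (n : ℕ) : Sym := if h : 0 < n then MvPowerSeries.X (Par.y ⟨n, h⟩) else 0

/-- `ũ_n`, with `ũ_0 = 0`. -/
def ut (n : ℕ) : Sym := if h : 0 < n then MvPowerSeries.X (Par.ut ⟨n, h⟩) else 0

/-- `ε`. -/
def eps : Sym := MvPowerSeries.X Par.eps

/-- `S_j((ε - D_w) ũ)`. -/
def Su (j : ℤ) : Sym := schur (fun n => (eps - Dw) * ut n) j

/-- `exp(∑_{s>0} y_s D_{x_s}) exp(∑_{s>0} ũ_s D_{u_s})`. -/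
def expD : Sym :=
  fexp (formalSum fun s : ℕ => y s * Dx s) * fexp (formalSum fun s : ℕ => ut s * Du s)

/-- The operator in square brackets, depending on `p = m - n`:
`p² + ∑_{r≥0} {2p D_{x_r} + ∑_{j+k=r; j,k>0} D_{x_j} D_{x_k} + 2 ∑_{k>0} k y_k D_{x_{r+k}}
  + 2 ∑_{k>0} (k-r) ũ_{k-r} D_{u_k}} S_r((ε - D_w) ũ)`,
where `ũ_{k-r} = 0` for `k ≤ r` (the subtraction `k - r` in `ℕ` is truncated and `ũ_0 = 0`). -/
def cartanPart (p : ℤ) : Sym :=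
  (p : Sym) ^ 2 +
    formalSum fun r : ℕ =>
      (2 * (p : Sym) * Dx r +
        (∑ jk ∈ Finset.HasAntidiagonal.antidiagonal r, Dx jk.1 * Dx jk.2) +
        2 * (formalSum fun k : ℕ => (k : Sym) * y k * Dx (r + k)) +
        2 * (formalSum fun k : ℕ => ((k - r : ℕ) : Sym) * ut (k - r) * Du k)) * Su r

/-- `∑_{r≥0} ∑_{j+k=r} S_j((ε - D_w) ũ) S_k(2σy) S_{r-2+2σp}(-2σ D̃_x)`, where
`D̃_{x_n} = (1/n) D_{x_n}`, `σ = ±1` and `p = m - n`. -/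
def rootPart (σ p : ℤ) : Sym :=
  formalSum fun r : ℕ =>
    ∑ jk ∈ Finset.HasAntidiagonal.antidiagonal r,
      Su jk.1 * schur (fun n => 2 * (σ : Sym) * y n) jk.2 *
        schur (fun n => ((-2 * (σ : ℂ)) * (n : ℂ)⁻¹) • Dx n) ((r : ℤ) - 2 + 2 * σ * p)

/-- The system of Hirota bilinear equations for `τ = ∑_s τ_s e^{sα}`. -/
def BilinearSystem (τ : Fock) : Prop :=
  ∀ m n : ℤ,
    hirota (cartanPart (m - n) * expD) (τ m) (τ n) +
      ((-1 : ℂ) ^ (m - n)) • hirota (rootPart 1 (m - n) * expD) (τ (m - 1)) (τ (n + 1)) +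
      ((-1 : ℂ) ^ (m - n)) • hirota (rootPart (-1) (m - n) * expD) (τ (m + 1)) (τ (n - 1)) = 0

end TwoToroidal

end

/-!
The vertex operators act diagonally on exponentials of linear forms, up to a translation of the
exponent. Ordered radially, the product `solitonTau` is therefore a finite sum over the sets `J`
of solitons (`solitonTau_eq_solitonSum`): the exponential of the sum of the phases of `J`, placed
in degree `charge ε J`, with coefficient `solitonCoeff`, a sign times the product of the `a_j` and
of the two-soliton factors `(z_j - z_i)^{2 ε_i ε_j}`. These coefficients are analytic on the
admissible set, so `solitonSum` is the continuation, and for equal signs it is the closed form.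

A Hirota polynomial acts on a pair of exponentials by evaluation at the difference of their linear
forms (`coeff_hirota_expLin`). For a pair `(J, K)` this difference is `∑ η_i ∑ z_i^n x_n + ⋯` with
`η_i ∈ {-1, 0, 1}`, the indicator of `J` minus that of `K`, weighted by `ε`; the symbols of the
system then become explicit power series in the parameters. The sum over `r` of the Cartan part is
a residue of the square of a current with simple poles at the `z_i`, and
`evalSym_cartanPart_eq_sum_residues` writes it as the sum over `i` of `η_i² · residueTerm i`. The
Schur polynomials of power sums in the root part of sign `σ` are the coefficients at infinity of
the rational function `∏ (ζ - z_i)^{2 σ η_i}`, which has double poles at the `z_j` with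
`σ η_j = -1`; the residue theorem (`coeff_polyInf_div`) turns them into sums over these poles
(`schur_powerSum_eq_sum_residues`).

The terms cancel in pairs. Moving the soliton `j` from one of the sets `J`, `K` to the other
(`flipPair j`) keeps the product of the two exponentials, shifts the degrees `(m, n)` to
`(m - σ, n + σ)`, and turns the residue of the root part at `z_j` into that of the Cartan part
(`residueTerm_mul_evalSym_expD`). The factor relating the coefficients of the two pairs is exactly
the value at `z_j` of the remaining factors of the rational function, up to the sign
`-(-1)^{m-n}` (`solitonCoeff_mul_add_flipPair`). This proves the system for distinct `z_i`; the
other admissible points follow by continuity.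
-/

noncomputable section

namespace TwoToroidal

open MvPowerSeries

/-! ### The formal exponential -/

section FormalExp

lemma coeff_pow_eq_zero {σ A : Type*} [CommRing A] {F : MvPowerSeries σ A}
    (hF : constantCoeff F = 0) {d : σ →₀ ℕ} {n : ℕ} (h : d.degree < n) : coeff d (F ^ n) = 0 :=
  coeff_of_lt_order (lt_of_lt_of_le (by exact_mod_cast h)
    (le_order_pow_of_constantCoeff_eq_zero n hF))

/-- A coefficient of a product depends only on the coefficients of at most its degree. -/
lemma coeff_mul_congr {σ A : Type*} [CommRing A] {F F' G G' : MvPowerSeries σ A} {d : σ →₀ ℕ}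
    (hF : ∀ e, e.degree ≤ d.degree → coeff e F = coeff e F')
    (hG : ∀ e, e.degree ≤ d.degree → coeff e G = coeff e G') :
    coeff d (F * G) = coeff d (F' * G') := by
  classical
  rw [coeff_mul, coeff_mul]
  refine Finset.sum_congr rfl fun p hp => ?_
  have h := congrArg (Finsupp.degree (R := ℕ)) (Finset.HasAntidiagonal.mem_antidiagonal.1 hp)
  rw [map_add] at h
  rw [hF _ (by omega), hG _ (by omega)]

variable {σ A : Type*} [CommRing A] [Algebra ℂ A]

lemma coeff_complex_smul (c : ℂ) (d : σ →₀ ℕ) (F : MvPowerSeries σ A) :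
    coeff d (c • F) = c • coeff d F := rfl

/-- Each coefficient of `exp F` is computed by a partial sum of the exponential series. -/
lemma coeff_fexp {F : MvPowerSeries σ A} (hF : constantCoeff F = 0) (d : σ →₀ ℕ) {N : ℕ}
    (h : d.degree < N) :
    coeff d (fexp F) = coeff d (∑ k ∈ Finset.range N, (k.factorial : ℂ)⁻¹ • F ^ k) := by
  rw [fexp, PowerSeries.coeff_subst (PowerSeries.HasSubst.of_constantCoeff_zero hF),
    finsum_eq_sum_of_support_subset (s := Finset.range N), map_sum]
  · refine Finset.sum_congr rfl fun k _ => ?_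
    rw [coeff_complex_smul]
    simp [PowerSeries.coeff_exp]
  · intro k hk
    by_contra hk'
    refine hk ?_
    simp only [Finset.coe_range, Set.mem_Iio, not_lt] at hk'
    simp [coeff_pow_eq_zero hF (lt_of_lt_of_le h hk')]

lemma constantCoeff_fexp {F : MvPowerSeries σ A} (hF : constantCoeff F = 0) :
    constantCoeff (fexp F) = 1 := by
  rw [← coeff_zero_eq_constantCoeff_apply, coeff_fexp hF 0 (N := 1) (by simp)]
  simp

lemma fexp_zero : fexp (0 : MvPowerSeries σ A) = 1 := by
  ext d
  rw [coeff_fexp (by simp) d (N := d.degree + 1) (by omega), Finset.sum_range_succ']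
  simp

lemma map_fexp {A' : Type*} [CommRing A'] [Algebra ℂ A'] (φ : A →ₐ[ℂ] A') {F : MvPowerSeries σ A}
    (hF : constantCoeff F = 0) :
    MvPowerSeries.map (φ : A →+* A') (fexp F) = fexp (MvPowerSeries.map (φ : A →+* A') F) := by
  ext d
  have hF' : constantCoeff (MvPowerSeries.map (φ : A →+* A') F) = 0 := by
    rw [constantCoeff_map, hF, map_zero]
  rw [coeff_map, coeff_fexp hF d (N := d.degree + 1) (by omega),
    coeff_fexp hF' d (N := d.degree + 1) (by omega), map_sum, map_sum, map_sum]
  refine Finset.sum_congr rfl fun k _ => ?_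
  rw [coeff_complex_smul, coeff_complex_smul, ← map_pow, coeff_map]
  simp

lemma fexp_add {F G : MvPowerSeries σ A} (hF : constantCoeff F = 0) (hG : constantCoeff G = 0) :
    fexp (F + G) = fexp F * fexp G := by
  ext d
  set N := d.degree + 1 with hN
  have hFG : constantCoeff (F + G) = 0 := by rw [map_add, hF, hG, add_zero]
  rw [coeff_fexp hFG d (N := N) (by omega),
    coeff_mul_congr (fun e he => coeff_fexp hF e (N := N) (by omega))
      (fun e he => coeff_fexp hG e (N := N) (by omega))]
  set a : ℕ × ℕ → MvPowerSeries σ A := fun p =>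
    ((p.1.factorial : ℂ)⁻¹ * (p.2.factorial : ℂ)⁻¹) • (F ^ p.1 * G ^ p.2) with ha
  have h1 : (∑ k ∈ Finset.range N, (k.factorial : ℂ)⁻¹ • F ^ k) *
      (∑ k ∈ Finset.range N, (k.factorial : ℂ)⁻¹ • G ^ k) =
      ∑ p ∈ Finset.range N ×ˢ Finset.range N, a p := by
    rw [Finset.sum_mul_sum, Finset.sum_product]
    refine Finset.sum_congr rfl fun i _ => Finset.sum_congr rfl fun j _ => ?_
    rw [smul_mul_smul_comm]
  have h2 : ∑ k ∈ Finset.range N, (k.factorial : ℂ)⁻¹ • (F + G) ^ k =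
      ∑ p ∈ (Finset.range N ×ˢ Finset.range N) with p.1 + p.2 < N, a p := by
    rw [← Finset.sum_fiberwise_of_maps_to (g := fun p : ℕ × ℕ => p.1 + p.2)
      (t := Finset.range N) (by simp)]
    refine Finset.sum_congr rfl fun k hk => ?_
    rw [Finset.mem_range] at hk
    have : {p ∈ {p ∈ Finset.range N ×ˢ Finset.range N | p.1 + p.2 < N} | p.1 + p.2 = k} =
        Finset.HasAntidiagonal.antidiagonal k := by
      ext p
      rw [Finset.HasAntidiagonal.mem_antidiagonal]
      simp only [Finset.mem_filter, Finset.mem_product, Finset.mem_range]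
      omega
    rw [this, (Commute.all F G).add_pow', Finset.smul_sum]
    refine Finset.sum_congr rfl fun p hp => ?_
    rw [Finset.HasAntidiagonal.mem_antidiagonal] at hp
    subst hp
    rw [← Nat.cast_smul_eq_nsmul ℂ, smul_smul, ha]
    congr 1
    rw [Nat.cast_add_choose]
    have := Nat.factorial_ne_zero (p.1 + p.2)
    field_simp
  rw [h1, h2, map_sum, map_sum, Finset.sum_filter]
  refine Finset.sum_congr rfl fun p _ => ?_
  split_ifs with h
  · rfl
  · have : (d.degree : ℕ∞) < (F ^ p.1 * G ^ p.2).order := by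
      refine lt_of_lt_of_le ?_ (le_trans (add_le_add
        (le_order_pow_of_constantCoeff_eq_zero p.1 hF)
        (le_order_pow_of_constantCoeff_eq_zero p.2 hG)) le_order_mul)
      have : d.degree < p.1 + p.2 := by omega
      exact_mod_cast this
    simp only [ha]
    rw [coeff_complex_smul, coeff_of_lt_order this, smul_zero]

lemma fexp_sum {ι : Type*} (s : Finset ι) (F : ι → MvPowerSeries σ A)
    (hF : ∀ i ∈ s, constantCoeff (F i) = 0) :
    fexp (∑ i ∈ s, F i) = ∏ i ∈ s, fexp (F i) := by
  classical
  induction s using Finset.induction_on with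
  | empty => simp [fexp_zero]
  | insert i s hi ih =>
    have hs : ∀ j ∈ s, constantCoeff (F j) = 0 := fun j hj => hF j (Finset.mem_insert_of_mem hj)
    rw [Finset.sum_insert hi, Finset.prod_insert hi, fexp_add (hF i (Finset.mem_insert_self _ _))
      (by rw [map_sum]; exact Finset.sum_eq_zero hs), ih hs]

/-- The chain rule for a derivation that lowers the degree by at most one. -/
lemma derivation_fexp {R : Type*} [CommRing R] [Algebra R A]
    (D : Derivation R (MvPowerSeries σ A) (MvPowerSeries σ A))
    (hD : ∀ (f : MvPowerSeries σ A) (d : σ →₀ ℕ),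
      (∀ e : σ →₀ ℕ, e.degree ≤ d.degree + 1 → coeff e f = 0) → coeff d (D f) = 0)
    (hDC : ∀ (c : ℂ) (f : MvPowerSeries σ A), D (c • f) = c • D f)
    {F : MvPowerSeries σ A} (hF : constantCoeff F = 0) : D (fexp F) = fexp F * D F := by
  ext d
  set N := d.degree + 1 with hN
  have h1 : coeff d (D (fexp F)) =
      coeff d (D (∑ k ∈ Finset.range (N + 1), (k.factorial : ℂ)⁻¹ • F ^ k)) := by
    rw [← sub_eq_zero, ← map_sub, ← map_sub]
    refine hD _ _ fun e he => ?_
    rw [map_sub, coeff_fexp hF e (N := N + 1) (by omega), sub_self]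
  rw [h1, coeff_mul_congr (fun e he => coeff_fexp hF e (N := N) (by omega)) (fun e he => rfl),
    map_sum, Finset.sum_range_succ', Finset.sum_mul]
  simp only [hDC, Derivation.leibniz_pow, pow_zero, Derivation.map_one_eq_zero, smul_zero,
    add_zero, Nat.add_sub_cancel]
  congr 1
  refine Finset.sum_congr rfl fun k _ => ?_
  rw [smul_eq_mul, ← Nat.cast_smul_eq_nsmul ℂ, smul_smul, Nat.factorial_succ, smul_mul_assoc]
  congr 1
  push_cast
  have : (k.factorial : ℂ) ≠ 0 := by exact_mod_cast Nat.factorial_ne_zero k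
  have : (k : ℂ) + 1 ≠ 0 := by exact_mod_cast Nat.succ_ne_zero k
  field_simp

lemma pderiv_fexp (v : σ) {F : MvPowerSeries σ ℂ} (hF : constantCoeff F = 0) :
    pderiv ℂ v (fexp F) = fexp F * pderiv ℂ v F := by
  refine derivation_fexp _ (fun f d h => ?_) (fun c f => Derivation.map_smul _ c f) hF
  rw [coeff_pderiv, h _ (by simp), zero_mul]

end FormalExp

/-! ### Linear power series -/

section LinearSeries

variable {σ A : Type*} [CommRing A]

/-- The linear form `∑ c_v X_v` in possibly infinitely many variables. -/
def linearSeries (c : σ → A) : MvPowerSeries σ A := formalSum fun v => C (c v) * X v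

lemma coeff_linearSeries_single (c : σ → A) (v : σ) :
    coeff (Finsupp.single v 1) (linearSeries c) = c v := by
  classical
  change ∑ᶠ i, coeff (Finsupp.single v 1) (C (c i) * X i) = c v
  rw [finsum_eq_single _ v]
  · simp [coeff_C_mul, coeff_X]
  · intro i hi
    rw [coeff_C_mul, coeff_X, if_neg, mul_zero]
    rw [Finsupp.single_left_inj one_ne_zero]
    exact hi.symm

lemma coeff_linearSeries_of_ne (c : σ → A) (d : σ →₀ ℕ) (h : ∀ v, d ≠ Finsupp.single v 1) :
    coeff d (linearSeries c) = 0 := by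
  classical
  change ∑ᶠ i, coeff d (C (c i) * X i) = 0
  rw [← finsum_zero (α := σ)]
  refine finsum_congr fun i => ?_
  rw [coeff_C_mul, coeff_X, if_neg (h i), mul_zero]

/-- A series with only linear terms is determined by its linear coefficients. -/
lemma eq_linearSeries {F : MvPowerSeries σ A} {c : σ → A}
    (h1 : ∀ v, coeff (Finsupp.single v 1) F = c v)
    (h2 : ∀ d : σ →₀ ℕ, (∀ v, d ≠ Finsupp.single v 1) → coeff d F = 0) : F = linearSeries c := by
  ext d
  by_cases h : ∃ v, d = Finsupp.single v 1
  · obtain ⟨v, rfl⟩ := h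
    rw [h1, coeff_linearSeries_single]
  · push Not at h
    rw [h2 d h, coeff_linearSeries_of_ne _ d h]

lemma linearSeries_add (c c' : σ → A) :
    linearSeries (c + c') = linearSeries c + linearSeries c' :=
  (eq_linearSeries (fun v => by simp [coeff_linearSeries_single])
    fun d h => by simp [coeff_linearSeries_of_ne _ d h]).symm

lemma C_mul_linearSeries (a : A) (c : σ → A) :
    C a * linearSeries c = linearSeries fun v => a * c v :=
  eq_linearSeries (fun v => by rw [coeff_C_mul, coeff_linearSeries_single])
    fun d h => by rw [coeff_C_mul, coeff_linearSeries_of_ne _ d h, mul_zero]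

lemma linearSeries_sum {ι : Type*} (s : Finset ι) (c : ι → σ → A) :
    linearSeries (∑ i ∈ s, c i) = ∑ i ∈ s, linearSeries (c i) :=
  (eq_linearSeries (fun v => by simp [coeff_linearSeries_single])
    fun d h => by simp [coeff_linearSeries_of_ne _ d h]).symm

lemma map_linearSeries {A' : Type*} [CommRing A'] (φ : A →+* A') (c : σ → A) :
    MvPowerSeries.map φ (linearSeries c) = linearSeries fun v => φ (c v) :=
  eq_linearSeries (fun v => by rw [coeff_map, coeff_linearSeries_single])
    fun d h => by rw [coeff_map, coeff_linearSeries_of_ne _ d h, map_zero]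

lemma constantCoeff_linearSeries (c : σ → A) : constantCoeff (linearSeries c) = 0 := by
  rw [← coeff_zero_eq_constantCoeff_apply, coeff_linearSeries_of_ne]
  intro v h
  have := DFunLike.congr_fun h v
  simp at this

end LinearSeries

/-! ### Linear forms and their exponentials -/

lemma linForm_eq (c : Var → ℂ) : linForm c = linearSeries c := rfl

lemma constantCoeff_linForm (c : Var → ℂ) : constantCoeff (linForm c) = 0 :=
  constantCoeff_linearSeries c

lemma pderiv_linForm (c : Var → ℂ) (v : Var) : pderiv ℂ v (linForm c) = C (c v) := by
  classical
  ext d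
  rw [coeff_pderiv, coeff_C]
  split_ifs with h
  · subst h
    simp [linForm_eq, coeff_linearSeries_single]
  · rw [linForm_eq, coeff_linearSeries_of_ne, zero_mul]
    intro v' h'
    refine h ?_
    have h1 := congrArg (Finsupp.degree (R := ℕ)) h'
    rw [map_add, Finsupp.degree_single, Finsupp.degree_single] at h1
    exact (Finsupp.degree_eq_zero_iff d).1 (by omega)

/-- The exponential of the linear form with coefficients `c`. -/
def expLin (c : Var → ℂ) : Ser := fexp (linForm c)

lemma expLin_add (c c' : Var → ℂ) : expLin (c + c') = expLin c * expLin c' := by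
  rw [expLin, linForm_eq, linearSeries_add,
    fexp_add (constantCoeff_linearSeries c) (constantCoeff_linearSeries c')]
  rfl

lemma expLin_zero : expLin 0 = 1 := by
  have : linForm 0 = 0 := by
    have := linearSeries_add (0 : Var → ℂ) 0
    rwa [add_zero, left_eq_add] at this
  rw [expLin, this, fexp_zero]

/-- Exponentials are joint eigenvectors of the partial derivatives. -/
lemma pderiv_expLin (c : Var → ℂ) (v : Var) : pderiv ℂ v (expLin c) = c v • expLin c := by
  rw [expLin, pderiv_fexp v (constantCoeff_linForm c), pderiv_linForm, mul_comm,
    smul_eq_C_mul]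

/-! ### The annihilation part of the vertex operator on exponentials -/

section Annihilation

variable {ι : Type*} {s : Finset ι} {σ : ℤ} {z : ℂ} {c : ι → Var → ℂ} {ev : ι → ℂ}

lemma hasSum_annSummand
    (h : ∀ i ∈ s, HasSum (fun n : ℕ+ => -2 * (σ : ℂ) * (n : ℂ)⁻¹ * (z ^ (n : ℕ))⁻¹ * c i (.x n))
      (ev i)) (b : ι → ℂ) (d : Var →₀ ℕ) :
    HasSum (fun n : ℕ+ => coeff d (annSummand σ z (∑ i ∈ s, b i • expLin (c i)) n))
      (coeff d (∑ i ∈ s, (ev i * b i) • expLin (c i))) := by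
  have : ∀ n : ℕ+, coeff d (annSummand σ z (∑ i ∈ s, b i • expLin (c i)) n) =
      ∑ i ∈ s, (-2 * (σ : ℂ) * (n : ℂ)⁻¹ * (z ^ (n : ℕ))⁻¹ * c i (.x n)) *
        (b i * coeff d (expLin (c i))) := by
    intro n
    simp only [annSummand, map_sum, Derivation.map_smul, pderiv_expLin, coeff_smul,
      Finset.mul_sum]
    refine Finset.sum_congr rfl fun i _ => ?_
    ring
  simp only [this, map_sum, coeff_smul]
  refine hasSum_sum fun i hi => ?_
  rw [mul_assoc]
  exact (h i hi).mul_right _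

lemma ann_sum_expLin
    (h : ∀ i ∈ s, HasSum (fun n : ℕ+ => -2 * (σ : ℂ) * (n : ℂ)⁻¹ * (z ^ (n : ℕ))⁻¹ * c i (.x n))
      (ev i)) (b : ι → ℂ) :
    ann σ z (∑ i ∈ s, b i • expLin (c i)) = ∑ i ∈ s, (ev i * b i) • expLin (c i) := by
  ext d
  exact (hasSum_annSummand h b d).tsum_eq

lemma ann_iterate_sum_expLin
    (h : ∀ i ∈ s, HasSum (fun n : ℕ+ => -2 * (σ : ℂ) * (n : ℂ)⁻¹ * (z ^ (n : ℕ))⁻¹ * c i (.x n))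
      (ev i)) (b : ι → ℂ) (j : ℕ) :
    (ann σ z)^[j] (∑ i ∈ s, b i • expLin (c i)) = ∑ i ∈ s, (ev i ^ j * b i) • expLin (c i) := by
  induction j with
  | zero => simp
  | succ j ih =>
    rw [Function.iterate_succ_apply', ih, ann_sum_expLin h]
    refine Finset.sum_congr rfl fun i _ => ?_
    rw [pow_succ']
    ring_nf

lemma hasSum_expAnn
    (h : ∀ i ∈ s, HasSum (fun n : ℕ+ => -2 * (σ : ℂ) * (n : ℂ)⁻¹ * (z ^ (n : ℕ))⁻¹ * c i (.x n))
      (ev i)) (b : ι → ℂ) (d : Var →₀ ℕ) :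
    HasSum (fun j : ℕ => ((j.factorial : ℂ)⁻¹) *
        coeff d ((ann σ z)^[j] (∑ i ∈ s, b i • expLin (c i))))
      (coeff d (∑ i ∈ s, (Complex.exp (ev i) * b i) • expLin (c i))) := by
  simp only [ann_iterate_sum_expLin h, map_sum, coeff_smul, Finset.mul_sum]
  refine hasSum_sum fun i _ => ?_
  have := (NormedSpace.expSeries_div_hasSum_exp (𝔸 := ℂ) (ev i)).mul_right
    (b i * coeff d (expLin (c i)))
  rw [← Complex.exp_eq_exp_ℂ, ← mul_assoc] at this
  refine (congrArg (fun f => HasSum f _) (funext fun j => ?_)).mp this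
  rw [div_eq_mul_inv]
  ring

lemma expAnnConverges_sum_expLin
    (h : ∀ i ∈ s, HasSum (fun n : ℕ+ => -2 * (σ : ℂ) * (n : ℂ)⁻¹ * (z ^ (n : ℕ))⁻¹ * c i (.x n))
      (ev i)) (b : ι → ℂ) : ExpAnnConverges σ z (∑ i ∈ s, b i • expLin (c i)) := by
  refine ⟨fun j d => ?_, fun d => (hasSum_expAnn h b d).summable⟩
  rw [ann_iterate_sum_expLin h]
  exact (hasSum_annSummand h _ d).summable

lemma expAnn_sum_expLin
    (h : ∀ i ∈ s, HasSum (fun n : ℕ+ => -2 * (σ : ℂ) * (n : ℂ)⁻¹ * (z ^ (n : ℕ))⁻¹ * c i (.x n))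
      (ev i)) (b : ι → ℂ) :
    expAnn σ z (∑ i ∈ s, b i • expLin (c i)) =
      ∑ i ∈ s, (Complex.exp (ev i) * b i) • expLin (c i) := by
  ext d
  exact (hasSum_expAnn h b d).tsum_eq

end Annihilation

/-! ### Soliton vectors -/

/-- The coefficients of the linear form `σ ∑ zⁿ x_n + k (w + ∑ zⁿ u_n)` of one soliton. -/
def phase (σ k : ℤ) (z : ℂ) : Var → ℂ
  | .x n => (σ : ℂ) * z ^ (n : ℕ)
  | .u n => (k : ℂ) * z ^ (n : ℕ)
  | .w => (k : ℂ)

lemma expX_mul_expU (σ k : ℤ) (z : ℂ) : expX σ z * expU k z = expLin (phase σ k z) := by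
  have : phase σ k z = (fun
      | .x n => (σ : ℂ) * z ^ (n : ℕ)
      | .u _ => 0
      | .w => 0) + (fun
      | .x _ => 0
      | .u n => (k : ℂ) * z ^ (n : ℕ)
      | .w => (k : ℂ)) := by
    funext v
    cases v <;> simp [phase]
  rw [this, expLin_add]
  rfl

section Coefficient

variable {ι : Type*} [LinearOrder ι]

/-- The product of the two-soliton interactions `(z_j - z_i)^{2 ε_i ε_j}` over the pairs in `J`. -/
def interaction (ε : ι → ℤˣ) (z : ι → ℂ) (J : Finset ι) : ℂ :=
  ∏ i ∈ J, ∏ j ∈ J with i < j, (z j - z i) ^ (2 * ((ε i : ℤ) * ε j))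

/-- The coefficient of the exponential labelled by the set `J` of solitons. The sign comes from the
cocycle: inserting a soliton into a set of `r` solitons costs `(-1)^r`. -/
def solitonCoeff (ε : ι → ℤˣ) (a z : ι → ℂ) (J : Finset ι) : ℂ :=
  (-1) ^ (J.card / 2) * (∏ j ∈ J, a j) * interaction ε z J

/-- The total charge of the set `J` of solitons, i.e. the lattice degree of its exponential. -/
def charge (ε : ι → ℤˣ) (J : Finset ι) : ℤ := ∑ j ∈ J, (ε j : ℤ)

/-- The sum over all sets of solitons, which continues `solitonTau` analytically. -/
def solitonSum [Fintype ι] (ε : ι → ℤˣ) (a : ι → ℂ) (k : ι → ℤ) (z : ι → ℂ) : Fock :=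
  ∑ J : Finset ι, term (solitonCoeff ε a z J • expLin (∑ j ∈ J, phase (ε j) (k j) (z j)))
    (charge ε J)

lemma zpow_two_mul_sub_comm (x y : ℂ) (n : ℤ) : (x - y) ^ (2 * n) = (y - x) ^ (2 * n) := by
  rw [zpow_mul, zpow_mul, ← neg_sub y x]
  norm_cast
  rw [neg_sq]

lemma interaction_insert (ε : ι → ℤˣ) (z : ι → ℂ) {J : Finset ι} {j : ι} (hj : j ∉ J) :
    interaction ε z (insert j J) =
      (∏ i ∈ J, (z j - z i) ^ (2 * ((ε j : ℤ) * ε i))) * interaction ε z J := by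
  simp only [interaction, Finset.prod_filter, Finset.prod_insert hj, lt_irrefl, if_false, one_mul,
    Finset.prod_mul_distrib]
  rw [← mul_assoc, ← Finset.prod_mul_distrib]
  congr 1
  refine Finset.prod_congr rfl fun i hi => ?_
  have hij : i ≠ j := fun h => hj (h ▸ hi)
  rcases lt_or_gt_of_ne hij with h | h
  · rw [if_neg h.le.not_gt, if_pos h, one_mul, mul_comm (ε i : ℤ)]
  · rw [if_pos h, if_neg h.le.not_gt, mul_one, zpow_two_mul_sub_comm]

lemma neg_one_pow_succ_div_two (r : ℕ) :
    (-1 : ℂ) ^ ((r + 1) / 2) = (-1) ^ r * (-1) ^ (r / 2) := by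
  rcases Nat.even_or_odd' r with ⟨k, rfl | rfl⟩
  · rw [show (2 * k + 1) / 2 = k by omega, show 2 * k / 2 = k by omega, pow_mul]
    simp
  · rw [show (2 * k + 1 + 1) / 2 = k + 1 by omega, show (2 * k + 1) / 2 = k by omega, pow_succ,
      pow_succ, pow_mul]
    simp

lemma solitonCoeff_insert (ε : ι → ℤˣ) (a z : ι → ℂ) {J : Finset ι} {j : ι} (hj : j ∉ J) :
    solitonCoeff ε a z (insert j J) =
      (-1) ^ J.card * a j * (∏ i ∈ J, (z j - z i) ^ (2 * ((ε j : ℤ) * ε i))) *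
        solitonCoeff ε a z J := by
  rw [solitonCoeff, solitonCoeff, interaction_insert ε z hj, Finset.card_insert_of_notMem hj,
    Finset.prod_insert hj, neg_one_pow_succ_div_two]
  ring

lemma solitonCoeff_map {κ : Type*} [LinearOrder κ] (f : κ ↪o ι) (ε : ι → ℤˣ) (a z : ι → ℂ)
    (J : Finset κ) :
    solitonCoeff ε a z (J.map f.toEmbedding) =
      solitonCoeff (fun i => ε (f i)) (fun i => a (f i)) (fun i => z (f i)) J := by
  simp [solitonCoeff, interaction, Finset.prod_filter]

end Coefficient

/-! ### The vertex operators on soliton vectors -/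

lemma solitonSum_apply {ι : Type*} [LinearOrder ι] [Fintype ι] (ε : ι → ℤˣ) (a : ι → ℂ)
    (k : ι → ℤ) (z : ι → ℂ) (s : ℤ) :
    solitonSum ε a k z s = ∑ J : Finset ι,
      (if s = charge ε J then solitonCoeff ε a z J else 0) •
        expLin (∑ j ∈ J, phase (ε j) (k j) (z j)) := by
  rw [solitonSum, Finset.sum_apply]
  refine Finset.sum_congr rfl fun J _ => ?_
  rw [term, Pi.single_apply]
  split_ifs <;> simp

lemma sum_finset_fin_succ {M : Type*} [AddCommMonoid M] {N : ℕ} (f : Finset (Fin (N + 1)) → M) :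
    ∑ J, f J = ∑ J : Finset (Fin N), f (J.map Fin.castSuccEmb) +
      ∑ J : Finset (Fin N), f (insert (Fin.last N) (J.map Fin.castSuccEmb)) := by
  classical
  have hlast : Fin.last N ∉ (Finset.univ : Finset (Fin N)).map Fin.castSuccEmb := by
    simp [Fin.ext_iff]
    intro x
    exact x.isLt.ne
  have huniv : (Finset.univ : Finset (Fin (N + 1))) =
      insert (Fin.last N) (Finset.univ.map Fin.castSuccEmb) := by
    ext x
    refine Fin.lastCases ?_ (fun i => ?_) x <;> simp
  have hmap : ∀ g : Finset (Fin (N + 1)) → M,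
      ∑ J ∈ ((Finset.univ : Finset (Fin N)).map Fin.castSuccEmb).powerset, g J =
        ∑ J : Finset (Fin N), g (J.map Fin.castSuccEmb) := by
    intro g
    have : ((Finset.univ : Finset (Fin N)).map Fin.castSuccEmb).powerset =
        (Finset.univ : Finset (Finset (Fin N))).map
          ⟨Finset.map Fin.castSuccEmb, Finset.map_injective _⟩ := by
      ext J
      simp only [Finset.mem_powerset, Finset.mem_map, Finset.mem_univ, true_and,
        Function.Embedding.coeFn_mk, Finset.subset_map_iff]
      constructor
      · rintro ⟨u, -, rfl⟩
        exact ⟨u, rfl⟩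
      · rintro ⟨u, rfl⟩
        exact ⟨u, Finset.subset_univ u, rfl⟩
    rw [this, Finset.sum_map]
    rfl
  rw [← Finset.powerset_univ, huniv, Finset.sum_powerset_insert hlast, hmap, hmap]

/-- The eigenvalue of `ann σ z` on the exponential labelled by `J`. The logarithmic series converge
because the new parameter `z` is larger than all those present. -/
lemma hasSum_eigenvalue {ι : Type*} (J : Finset ι) (σ : ℤ) (ε : ι → ℤˣ) (k : ι → ℤ) (y : ι → ℂ)
    {z : ℂ} (hz : ∀ j ∈ J, ‖y j‖ < ‖z‖) :
    HasSum (fun n : ℕ+ => -2 * (σ : ℂ) * (n : ℂ)⁻¹ * (z ^ (n : ℕ))⁻¹ *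
        (∑ j ∈ J, phase (ε j) (k j) (y j)) (.x n))
      (∑ j ∈ J, ((2 * (σ * ε j) : ℤ) : ℂ) * Complex.log (1 - y j / z)) := by
  simp only [Finset.sum_apply, Finset.mul_sum, phase]
  refine hasSum_sum fun j hj => ?_
  have hj1 : ‖y j / z‖ < 1 := by
    rw [norm_div, div_lt_one (lt_of_le_of_lt (norm_nonneg _) (hz j hj))]
    exact hz j hj
  have h := (Complex.hasSum_taylorSeries_neg_log hj1)
  have h' : HasSum (fun n : ℕ+ => (y j / z) ^ (n : ℕ) / (n : ℂ)) (-Complex.log (1 - y j / z)) := by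
    refine (Function.Injective.hasSum_iff (f := fun n : ℕ => (y j / z) ^ n / (n : ℂ))
      PNat.coe_injective ?_).2 h
    intro n hn
    have : n = 0 := by
      by_contra h0
      exact hn ⟨⟨n, Nat.pos_of_ne_zero h0⟩, rfl⟩
    simp [this]
  have h'' := h'.mul_left (-((2 * (σ * ε j) : ℤ) : ℂ))
  rw [neg_mul_neg] at h''
  refine (congrArg (fun f => HasSum f _) (funext fun n => ?_)).mp h''
  push_cast
  rw [div_pow]
  ring

/-- The exponential of the eigenvalue, completed by the power of `z` produced by `z^{σ∂_α}`, is a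
product of integral powers, free of logarithms. -/
lemma exp_eigenvalue {ι : Type*} (J : Finset ι) (e : ι → ℤ) (y : ι → ℂ) {z : ℂ}
    (hz : ∀ j ∈ J, ‖y j‖ < ‖z‖) :
    z ^ (∑ j ∈ J, e j) * Complex.exp (∑ j ∈ J, (e j : ℂ) * Complex.log (1 - y j / z)) =
      ∏ j ∈ J, (z - y j) ^ e j := by
  rw [Complex.exp_sum]
  by_cases hJ : J = ∅
  · simp [hJ]
  obtain ⟨i, hi⟩ := Finset.nonempty_iff_ne_empty.2 hJ
  have hz0 : z ≠ 0 := norm_pos_iff.1 (lt_of_le_of_lt (norm_nonneg _) (hz i hi))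
  have hsum : ∀ K : Finset ι, z ^ (∑ j ∈ K, e j) = ∏ j ∈ K, z ^ e j := by
    intro K
    induction K using Finset.cons_induction with
    | empty => simp
    | cons a s ha ih => rw [Finset.sum_cons, Finset.prod_cons, zpow_add₀ hz0, ih]
  rw [hsum, ← Finset.prod_mul_distrib]
  refine Finset.prod_congr rfl fun j hj => ?_
  have hne : 1 - y j / z ≠ 0 := by
    intro h
    have h1 : y j = z := by
      field_simp at h
      linear_combination -h
    exact (hz j hj).ne (by rw [h1])
  rw [Complex.exp_int_mul, Complex.exp_log hne, ← mul_zpow]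
  congr 1
  field_simp

lemma neg_one_zpow_charge {ι : Type*} [LinearOrder ι] (ε : ι → ℤˣ) (J : Finset ι) :
    (-1 : ℂ) ^ charge ε J = (-1) ^ J.card := by
  classical
  rw [charge]
  induction J using Finset.induction_on with
  | empty => simp
  | insert a s ha ih =>
    rw [Finset.sum_insert ha, Finset.card_insert_of_notMem ha, zpow_add₀ (by norm_num), ih,
      pow_succ, mul_comm]
    congr 1
    rcases Int.units_eq_one_or (ε a) with h | h <;> simp [h]

lemma cocycle_charge {ι : Type*} [LinearOrder ι] (σ : ℤˣ) (ε : ι → ℤˣ) (J : Finset ι) :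
    cocycle σ (charge ε J) = (-1) ^ J.card := by
  rw [← neg_one_zpow_charge ε J, cocycle]
  rcases Int.units_eq_one_or σ with h | h
  · simp [h]
  · simp [h, ← inv_zpow]

section Gam

variable {N : ℕ} (σ : ℤˣ) (l : ℤ) (y : ℂ) (ε : Fin N → ℤˣ) (a : Fin N → ℂ) (k : Fin N → ℤ)
  (z : Fin N → ℂ)

/-- The coefficient with which `J` contributes to the degree `s` component of the image of a
soliton vector under the inner part of a vertex operator. -/
def gammaCoeff (s : ℤ) (J : Finset (Fin N)) : ℂ :=
  if s = charge ε J + σ then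
    (-1) ^ J.card * y ^ (2 * ((σ : ℤ) * charge ε J)) * solitonCoeff ε a z J else 0

/-- The coefficients of the linear form `l (w + ∑ yⁿ u_n)`. -/
def phaseU : Var → ℂ
  | .x _ => 0
  | .u n => (l : ℂ) * y ^ (n : ℕ)
  | .w => (l : ℂ)

lemma gammaInner_solitonSum (s : ℤ) :
    gammaInner σ l y (solitonSum ε a k z) s = ∑ J : Finset (Fin N),
      gammaCoeff σ y ε a z s J • expLin (phaseU l y + ∑ j ∈ J, phase (ε j) (k j) (z j)) := by
  have hU : expU l y = expLin (phaseU l y) := rfl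
  simp only [expLin_add, ← hU, ← mul_smul_comm, ← Finset.mul_sum]
  rw [gammaInner, latticeMul, zPowPartial, solitonSum_apply, Finset.smul_sum, Finset.smul_sum]
  congr 1
  refine Finset.sum_congr rfl fun J _ => ?_
  rw [gammaCoeff]
  by_cases h : s = charge ε J + σ
  · have h' : s - σ = charge ε J := by omega
    rw [if_pos h, if_pos h', h', smul_smul, smul_smul, cocycle_charge, mul_assoc (2 : ℤ)]
  · have h' : s - σ ≠ charge ε J := by omega
    rw [if_neg h, if_neg h']
    simp

variable {z y}

lemma hasSum_eigenvalue_phaseU (hz : ∀ j, ‖z j‖ < ‖y‖) (J : Finset (Fin N)) :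
    HasSum (fun n : ℕ+ => -2 * ((σ : ℤ) : ℂ) * (n : ℂ)⁻¹ * (y ^ (n : ℕ))⁻¹ *
        (phaseU l y + ∑ j ∈ J, phase (ε j) (k j) (z j)) (.x n))
      (∑ j ∈ J, ((2 * (σ * ε j) : ℤ) : ℂ) * Complex.log (1 - z j / y)) := by
  have := hasSum_eigenvalue J σ ε k z fun j _ => hz j
  simpa only [Pi.add_apply, phaseU, zero_add] using this

lemma gamConverges_solitonSum (hz : ∀ j, ‖z j‖ < ‖y‖) :
    GamConverges σ l y (solitonSum ε a k z) := by
  intro s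
  rw [gammaInner_solitonSum]
  exact expAnnConverges_sum_expLin (fun J _ => hasSum_eigenvalue_phaseU σ l ε k hz J) _

lemma Gam_solitonSum (hz : ∀ j, ‖z j‖ < ‖y‖) (s : ℤ) :
    Gam σ l y (solitonSum ε a k z) s = ∑ J : Finset (Fin N),
      (if s = charge ε J + σ then
        (-1) ^ J.card * (∏ i ∈ J, (y - z i) ^ (2 * ((σ : ℤ) * ε i))) * solitonCoeff ε a z J
        else 0) • expLin (phase σ l y + ∑ j ∈ J, phase (ε j) (k j) (z j)) := by
  rw [Gam, gammaInner_solitonSum,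
    expAnn_sum_expLin (fun J _ => hasSum_eigenvalue_phaseU σ l ε k hz J), Finset.mul_sum]
  refine Finset.sum_congr rfl fun J _ => ?_
  rw [mul_smul_comm, expLin_add, ← mul_assoc, show expX σ y * expLin (phaseU l y) =
    expLin (phase σ l y) from expX_mul_expU σ l y, ← expLin_add]
  congr 1
  rw [gammaCoeff]
  split_ifs
  · rw [← exp_eigenvalue J _ z fun j _ => hz j, charge, Finset.mul_sum, Finset.mul_sum]
    ring
  · ring

end Gam

/-- The product of the operators `1 + a_i Γ_i` in the domain of convergence: each new soliton
either stays out or is inserted, with the factor produced by `solitonCoeff_insert`. -/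
lemma solitonTau_eq_solitonSum (N : ℕ) (ε : Fin N → ℤˣ) (a : Fin N → ℂ) (k : Fin N → ℤ)
    (z : Fin N → ℂ) (hz : RadiallyOrdered z) :
    SolitonConverges N ε a k z ∧ solitonTau N ε a k z = solitonSum ε a k z := by
  induction N with
  | zero =>
    refine ⟨trivial, ?_⟩
    rw [solitonTau, solitonSum, Fintype.sum_unique]
    have : (default : Finset (Fin 0)) = ∅ := rfl
    rw [this]
    simp [solitonCoeff, interaction, charge, expLin_zero, vac]
  | succ N ih =>
    obtain ⟨h1, h2⟩ := ih (fun i => ε i.castSucc) (fun i => a i.castSucc)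
      (fun i => k i.castSucc) (fun i => z i.castSucc)
      ⟨fun i => hz.1 _, fun i j hij => hz.2 _ _ (by simpa using hij)⟩
    have hlt : ∀ j : Fin N, ‖z j.castSucc‖ < ‖z (Fin.last N)‖ := fun j =>
      hz.2 _ _ (Fin.castSucc_lt_last j)
    rw [SolitonConverges, solitonTau, h2]
    refine ⟨⟨h1, gamConverges_solitonSum _ _ _ _ _ hlt⟩, ?_⟩
    funext s
    have hcoe : ∀ J : Finset (Fin N), J.map Fin.castSuccEmb =
        J.map (Fin.castSuccOrderEmb (n := N)).toEmbedding := fun J => rfl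
    have hlast : ∀ J : Finset (Fin N), Fin.last N ∉ J.map Fin.castSuccEmb := by
      intro J
      simp only [Finset.mem_map, not_exists, not_and]
      intro x _ h
      exact (Fin.castSucc_lt_last x).ne h
    rw [solitonSum_apply, sum_finset_fin_succ]
    simp only [Pi.add_apply, Pi.smul_apply]
    rw [solitonSum_apply, Gam_solitonSum _ _ _ _ _ hlt, Finset.smul_sum]
    congr 1
    · refine Finset.sum_congr rfl fun J _ => ?_
      rw [Finset.sum_map, charge, charge, Finset.sum_map, hcoe, solitonCoeff_map]
      rfl
    · refine Finset.sum_congr rfl fun J _ => ?_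
      rw [Finset.sum_insert (hlast J), Finset.sum_map, charge, charge,
        Finset.sum_insert (hlast J), Finset.sum_map, solitonCoeff_insert _ _ _ (hlast J), hcoe,
        solitonCoeff_map, smul_smul, mul_ite, mul_zero, add_comm ((ε (Fin.last N) : ℤˣ) : ℤ),
        Finset.prod_map, Finset.card_map]
      congr 1
      refine if_congr Iff.rfl ?_ rfl
      have hemb : ∀ i : Fin N, Fin.castSuccOrderEmb.toEmbedding i = i.castSucc := fun _ => rfl
      have hemb' : ∀ i : Fin N, Fin.castSuccOrderEmb i = i.castSucc := fun _ => rfl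
      simp only [hemb, hemb']
      ring

/-! ### Equal signs -/

lemma solitonSum_eq_closedForm {N : ℕ} (ε : Fin N → ℤˣ) (a : Fin N → ℂ) (k : Fin N → ℤ)
    (z : Fin N → ℂ) (σ : ℤˣ) (h : ∀ i, ε i = σ) : solitonSum ε a k z = closedForm σ a k z := by
  have hσ : ((σ : ℤ) * σ) = 1 := by
    rcases Int.units_eq_one_or σ with h | h <;> simp [h]
  rw [solitonSum, closedForm]
  refine Finset.sum_congr rfl fun J _ => ?_
  congr 1
  · rw [solitonCoeff, interaction, expLin]
    congr 2
    · simp only [h, hσ, mul_one]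
      norm_cast
    · congr 1
      funext v
      rw [Finset.sum_apply]
      cases v <;> simp [phase, h, Finset.mul_sum]
  · simp [charge, h, mul_comm]

/-! ### Analyticity -/

lemma analyticAt_coeff_pow {E : Type*} [NormedAddCommGroup E] [NormedSpace ℂ E] {σ : Type*}
    {F : E → MvPowerSeries σ ℂ} {x : E} (hF : ∀ d, AnalyticAt ℂ (fun z => coeff d (F z)) x)
    (n : ℕ) (d : σ →₀ ℕ) : AnalyticAt ℂ (fun z => coeff d (F z ^ n)) x := by
  classical
  induction n generalizing d with
  | zero => simpa using analyticAt_const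
  | succ n ih =>
    simp only [pow_succ, coeff_mul]
    exact Finset.analyticAt_fun_sum _ fun p _ => (ih p.1).mul (hF p.2)

lemma analyticAt_coeff_expLin {E : Type*} [NormedAddCommGroup E] [NormedSpace ℂ E]
    {c : E → Var → ℂ} {x : E} (hc : ∀ v, AnalyticAt ℂ (fun z => c z v) x) (d : Var →₀ ℕ) :
    AnalyticAt ℂ (fun z => coeff d (expLin (c z))) x := by
  simp only [expLin, fun z => coeff_fexp (constantCoeff_linForm (c z)) d (Nat.lt_succ_self _),
    map_sum, coeff_smul]
  refine Finset.analyticAt_fun_sum _ fun n _ => analyticAt_const.mul ?_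
  refine analyticAt_coeff_pow (fun e => ?_) n d
  by_cases h : ∃ v, e = Finsupp.single v 1
  · obtain ⟨v, rfl⟩ := h
    simpa only [linForm_eq, coeff_linearSeries_single] using hc v
  · push Not at h
    simpa only [linForm_eq, coeff_linearSeries_of_ne _ e h] using analyticAt_const

lemma analyticAt_sum_phase {N : ℕ} (ε k : Fin N → ℤ) (J : Finset (Fin N)) (v : Var)
    (x : Fin N → ℂ) :
    AnalyticAt ℂ (fun z : Fin N → ℂ => (∑ j ∈ J, phase (ε j) (k j) (z j)) v) x := by
  have hproj : ∀ j, AnalyticAt ℂ (fun z : Fin N → ℂ => z j) x := fun j =>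
    (ContinuousLinearMap.proj (R := ℂ) (φ := fun _ : Fin N => ℂ) j).analyticAt x
  simp only [Finset.sum_apply]
  refine Finset.analyticAt_fun_sum _ fun j _ => ?_
  cases v with
  | x n => exact analyticAt_const.mul ((hproj j).pow _)
  | u n => exact analyticAt_const.mul ((hproj j).pow _)
  | w => exact analyticAt_const

lemma analyticAt_solitonCoeff {N : ℕ} (ε : Fin N → ℤˣ) (a : Fin N → ℂ) (J : Finset (Fin N))
    {x : Fin N → ℂ} (hx : x ∈ admissible ε) :
    AnalyticAt ℂ (fun z : Fin N → ℂ => solitonCoeff ε a z J) x := by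
  have hproj : ∀ j, AnalyticAt ℂ (fun z : Fin N → ℂ => z j) x := fun j =>
    (ContinuousLinearMap.proj (R := ℂ) (φ := fun _ : Fin N => ℂ) j).analyticAt x
  refine analyticAt_const.mul ?_
  refine Finset.analyticAt_fun_prod _ fun i _ => Finset.analyticAt_fun_prod _ fun j _ => ?_
  by_cases h : ε i = ε j
  · have h2 : (2 * ((ε i : ℤ) * ε j)) = (2 : ℕ) := by
      rcases Int.units_eq_one_or (ε j) with h' | h' <;> simp [h, h']
    simp only [h2, zpow_natCast]
    exact ((hproj j).sub (hproj i)).pow 2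
  · exact ((hproj j).sub (hproj i)).zpow (sub_ne_zero.2 (hx.2 j i (Ne.symm h)))

lemma analyticOnNhd_solitonSum {N : ℕ} (ε : Fin N → ℤˣ) (a : Fin N → ℂ) (k : Fin N → ℤ)
    (s : ℤ) (d : Var →₀ ℕ) :
    AnalyticOnNhd ℂ (fun z => coeff d (solitonSum ε a k z s)) (admissible ε) := by
  intro x hx
  simp only [solitonSum_apply, map_sum, coeff_smul]
  refine Finset.analyticAt_fun_sum _ fun J _ => AnalyticAt.mul ?_ ?_
  · split_ifs
    · exact analyticAt_solitonCoeff ε a J hx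
    · exact analyticAt_const
  · exact analyticAt_coeff_expLin (fun v => analyticAt_sum_phase _ _ J v x) d

/-! ### Weighted components and elementary Schur polynomials -/

lemma map_schur {A A' : Type*} [CommRing A] [Algebra ℂ A] [CommRing A'] [Algebra ℂ A']
    (φ : A →ₐ[ℂ] A') (c : ℕ → A) (n : ℤ) : φ (schur c n) = schur (fun j => φ (c j)) n := by
  rw [schur, schur]
  split_ifs
  · have h0 : constantCoeff (σ := Unit)
        (PowerSeries.mk fun j => if j = 0 then (0 : A) else c j) = 0 := by
      change PowerSeries.constantCoeff _ = 0
      rw [← PowerSeries.coeff_zero_eq_constantCoeff_apply, PowerSeries.coeff_mk, if_pos rfl]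
    have h1 := map_fexp (σ := Unit) φ h0
    have h2 : MvPowerSeries.map (σ := Unit) (φ : A →+* A')
        (PowerSeries.mk fun j => if j = 0 then (0 : A) else c j) =
        PowerSeries.mk fun j => if j = 0 then (0 : A') else φ (c j) := by
      refine PowerSeries.ext fun j => ?_
      change PowerSeries.coeff j (PowerSeries.map (φ : A →+* A') _) = _
      rw [PowerSeries.coeff_map, PowerSeries.coeff_mk, PowerSeries.coeff_mk]
      split_ifs <;> simp
    rw [h2] at h1
    rw [← h1]
    change _ = PowerSeries.coeff _ (PowerSeries.map (φ : A →+* A') _)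
    rw [PowerSeries.coeff_map]
    rfl
  · exact map_zero φ

section Weight

variable {σ A : Type*} [CommRing A] (w : σ → ℕ)

lemma coeff_component (r : ℕ) (d : σ →₀ ℕ) (F : MvPowerSeries σ A) :
    coeff d (weightedHomogeneousComponent w r F) =
      if Finsupp.weight w d = r then coeff d F else 0 :=
  coeff_weightedHomogeneousComponent w r d F

lemma component_mul (n : ℕ) (F G : MvPowerSeries σ A) :
    weightedHomogeneousComponent w n (F * G) =
      ∑ p ∈ Finset.HasAntidiagonal.antidiagonal n,
        weightedHomogeneousComponent w p.1 F * weightedHomogeneousComponent w p.2 G := by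
  classical
  ext d
  simp only [coeff_component, map_sum, coeff_mul]
  rw [Finset.sum_comm]
  have h : ∀ q ∈ Finset.HasAntidiagonal.antidiagonal d,
      ∑ p ∈ Finset.HasAntidiagonal.antidiagonal n,
        ((if Finsupp.weight w q.1 = p.1 then coeff q.1 F else 0) *
          if Finsupp.weight w q.2 = p.2 then coeff q.2 G else 0) =
      if Finsupp.weight w d = n then coeff q.1 F * coeff q.2 G else 0 := by
    intro q hq
    rw [Finset.HasAntidiagonal.mem_antidiagonal] at hq
    rw [← hq, map_add]
    split_ifs with hn
    · rw [Finset.sum_eq_single (Finsupp.weight w q.1, Finsupp.weight w q.2)]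
      · simp
      · rintro ⟨a, b⟩ _ hab
        by_cases h1 : Finsupp.weight w q.1 = a
        · have h2 : Finsupp.weight w q.2 ≠ b := fun h2 => hab (by rw [h1, h2])
          simp [h2]
        · simp [h1]
      · intro h
        exact absurd (Finset.HasAntidiagonal.mem_antidiagonal.2 hn) h
    · refine Finset.sum_eq_zero fun p hp => ?_
      rw [Finset.HasAntidiagonal.mem_antidiagonal] at hp
      by_cases h1 : Finsupp.weight w q.1 = p.1
      · have h2 : Finsupp.weight w q.2 ≠ p.2 := fun h2 => hn (by rw [h1, h2, hp])
        simp [h2]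
      · simp [h1]
  rw [Finset.sum_congr rfl h]
  split_ifs <;> simp

lemma component_one (n : ℕ) :
    weightedHomogeneousComponent w n (1 : MvPowerSeries σ A) = if n = 0 then 1 else 0 := by
  classical
  ext d
  rw [coeff_component, coeff_one]
  by_cases hd : d = 0
  · subst hd
    by_cases hn : n = 0
    · simp [hn]
    · simp [hn, Ne.symm hn]
  · by_cases hn : n = 0
    · simp [hn, hd, coeff_one]
    · simp [hn, hd]

lemma coeff_mk_component_pow (F : MvPowerSeries σ A) (k n : ℕ) :
    PowerSeries.coeff n ((PowerSeries.mk fun j => weightedHomogeneousComponent w j F) ^ k) =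
      weightedHomogeneousComponent w n (F ^ k) := by
  induction k generalizing n with
  | zero => rw [pow_zero, pow_zero, PowerSeries.coeff_one, component_one]
  | succ k ih =>
    rw [pow_succ, pow_succ, PowerSeries.coeff_mul, component_mul]
    exact Finset.sum_congr rfl fun p _ => by rw [ih, PowerSeries.coeff_mk]

/-- If `c j` is the weight `j` component of `F`, then `S_r(c)` is the weight `r` component of
`exp F`. -/
lemma schur_eq_component [Algebra ℂ A] {c : ℕ → MvPowerSeries σ A} {F : MvPowerSeries σ A}
    (hc : ∀ j, 0 < j → c j = weightedHomogeneousComponent w j F)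
    (h0 : weightedHomogeneousComponent w 0 F = 0) (r : ℕ) :
    schur c r = weightedHomogeneousComponent w r (fexp F) := by
  have hmk : (PowerSeries.mk fun j => if j = 0 then 0 else c j) =
      PowerSeries.mk fun j => weightedHomogeneousComponent w j F := by
    refine PowerSeries.ext fun j => ?_
    rw [PowerSeries.coeff_mk, PowerSeries.coeff_mk]
    split_ifs with h
    · rw [h, h0]
    · exact hc j (Nat.pos_of_ne_zero h)
  have hF : constantCoeff F = 0 := by
    have := congrArg (coeff 0) h0
    rw [coeff_component, map_zero, if_pos rfl] at this
    exact this
  have hG : constantCoeff (σ := Unit)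
      (PowerSeries.mk fun j => weightedHomogeneousComponent w j F) = 0 := by
    change PowerSeries.constantCoeff _ = 0
    rw [← PowerSeries.coeff_zero_eq_constantCoeff_apply, PowerSeries.coeff_mk, h0]
  rw [schur, if_pos (Int.natCast_nonneg r), hmk, Int.toNat_natCast]
  ext d
  rw [coeff_component, coeff_fexp hF d (N := r + d.degree + 1) (by omega)]
  have h1 := coeff_fexp (σ := Unit) hG (Finsupp.single () r) (N := r + d.degree + 1)
    (by rw [Finsupp.degree_single]; omega)
  change PowerSeries.coeff r (fexp (σ := Unit) _) = PowerSeries.coeff r _ at h1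
  have h2 : ∀ k, PowerSeries.coeff r (((k.factorial : ℂ)⁻¹ •
      (PowerSeries.mk fun j => weightedHomogeneousComponent w j F) ^ k : PowerSeries _)) =
      (k.factorial : ℂ)⁻¹ • weightedHomogeneousComponent w r (F ^ k) := by
    intro k
    rw [← coeff_mk_component_pow]
    rfl
  have h3 : PowerSeries.coeff r (fexp (σ := Unit)
      (PowerSeries.mk fun j => weightedHomogeneousComponent w j F)) =
      ∑ k ∈ Finset.range (r + d.degree + 1),
        (k.factorial : ℂ)⁻¹ • weightedHomogeneousComponent w r (F ^ k) := by
    rw [h1, map_sum]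
    exact Finset.sum_congr rfl fun k _ => h2 k
  rw [h3, map_sum, map_sum]
  simp only [coeff_complex_smul, coeff_component]
  split_ifs <;> simp

/-- The product of a series with a component of large weight has no coefficient at `d`. -/
lemma coeff_mul_component_eq_zero {d : σ →₀ ℕ} {r : ℕ} (h : Finsupp.weight w d < r)
    (F G : MvPowerSeries σ A) :
    coeff d (F * weightedHomogeneousComponent w r G) = 0 := by
  classical
  rw [coeff_mul]
  refine Finset.sum_eq_zero fun p hp => ?_
  rw [Finset.HasAntidiagonal.mem_antidiagonal] at hp
  rw [coeff_component, if_neg, mul_zero]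
  rw [← hp, map_add] at h
  omega

lemma map_component {A' : Type*} [CommRing A'] (φ : A →+* A') (r : ℕ) (F : MvPowerSeries σ A) :
    MvPowerSeries.map φ (weightedHomogeneousComponent w r F) =
      weightedHomogeneousComponent w r (MvPowerSeries.map φ F) := by
  ext d
  rw [coeff_map, coeff_component, coeff_component, coeff_map]
  split_ifs <;> simp

end Weight

/-! ### Scaling by functions of the weight -/

section Scale

variable {σ A : Type*} [CommRing A] (w : σ → ℕ)

/-- Multiplication of the weight `r` component by `κ r`. -/
def weightScale (κ : ℕ → A) : MvPowerSeries σ A →ₗ[A] MvPowerSeries σ A where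
  toFun F := fun d => κ (Finsupp.weight w d) * coeff d F
  map_add' F G := by
    ext d
    exact mul_add _ _ _
  map_smul' c F := by
    ext d
    exact mul_left_comm _ _ _

lemma coeff_weightScale (κ : ℕ → A) (F : MvPowerSeries σ A) (d : σ →₀ ℕ) :
    coeff d (weightScale w κ F) = κ (Finsupp.weight w d) * coeff d F := rfl

lemma formalSum_component (κ : ℕ → A) (F : MvPowerSeries σ A) :
    (formalSum fun r : ℕ => C (κ r) * weightedHomogeneousComponent w r F) =
      weightScale w κ F := by
  ext d
  change ∑ᶠ r : ℕ, coeff d (C (κ r) * weightedHomogeneousComponent w r F) = _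
  rw [finsum_eq_single _ (Finsupp.weight w d)]
  · rw [coeff_C_mul, coeff_component, if_pos rfl, coeff_weightScale]
  · intro r hr
    rw [coeff_C_mul, coeff_component, if_neg hr.symm, mul_zero]

/-- The substitution `t_i ↦ z^{w i} t_i`, scaling the component of weight `r` by `z^r`. -/
def dilate (z : ℂ) : MvPowerSeries σ ℂ →+* MvPowerSeries σ ℂ := rescale fun i => z ^ w i

lemma dilate_eq_weightScale (z : ℂ) (F : MvPowerSeries σ ℂ) :
    dilate w z F = weightScale w (fun r => z ^ r) F := by
  ext d
  rw [coeff_weightScale, dilate, coeff_rescale, Finsupp.weight_apply, Finsupp.prod, Finsupp.sum,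
    ← Finset.prod_pow_eq_pow_sum]
  congr 1
  refine Finset.prod_congr rfl fun i _ => ?_
  rw [← pow_mul, smul_eq_mul, mul_comm]

lemma coeff_dilate (z : ℂ) (F : MvPowerSeries σ ℂ) (d : σ →₀ ℕ) :
    coeff d (dilate w z F) = z ^ Finsupp.weight w d * coeff d F := by
  rw [dilate_eq_weightScale, coeff_weightScale]

lemma constantCoeff_dilate (z : ℂ) {F : MvPowerSeries σ ℂ} (hF : constantCoeff F = 0) :
    constantCoeff (dilate w z F) = 0 := by
  rw [← coeff_zero_eq_constantCoeff_apply, coeff_dilate, coeff_zero_eq_constantCoeff_apply, hF,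
    mul_zero]

lemma dilate_fexp (z : ℂ) {F : MvPowerSeries σ ℂ} (hF : constantCoeff F = 0) :
    dilate w z (fexp F) = fexp (dilate w z F) := by
  ext d
  rw [coeff_dilate, coeff_fexp hF d (Nat.lt_succ_self _),
    coeff_fexp (constantCoeff_dilate w z hF) d (Nat.lt_succ_self _), ← coeff_dilate, map_sum]
  simp only [smul_eq_C_mul, map_mul, map_pow]
  congr 1
  refine Finset.sum_congr rfl fun k _ => ?_
  congr 1
  classical
  ext e
  rw [coeff_dilate, coeff_C]
  split_ifs with h
  · simp [h]
  · simp

/-- The Euler derivation, multiplying the component of weight `r` by `r`. -/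
def euler : Derivation ℂ (MvPowerSeries σ ℂ) (MvPowerSeries σ ℂ) :=
  Derivation.mk' (weightScale w fun r => (r : ℂ)) fun F G => by
    classical
    ext d
    rw [coeff_weightScale, map_add, smul_eq_mul, smul_eq_mul, coeff_mul, coeff_mul, mul_comm G,
      coeff_mul, Finset.mul_sum, ← Finset.sum_add_distrib]
    refine Finset.sum_congr rfl fun p hp => ?_
    rw [Finset.HasAntidiagonal.mem_antidiagonal] at hp
    rw [coeff_weightScale, coeff_weightScale, ← hp, map_add]
    push_cast
    ring

lemma coeff_euler (F : MvPowerSeries σ ℂ) (d : σ →₀ ℕ) :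
    coeff d (euler w F) = (Finsupp.weight w d : ℂ) * coeff d F := rfl

lemma euler_fexp {F : MvPowerSeries σ ℂ} (hF : constantCoeff F = 0) :
    euler w (fexp F) = fexp F * euler w F := by
  refine derivation_fexp _ (fun f d h => ?_) (fun c f => Derivation.map_smul _ c f) hF
  rw [coeff_euler, h d (by omega), mul_zero]

end Scale

/-! ### Sums over the weighted components of a series -/

section FormalSum

variable {σ A : Type*} [CommRing A] (w : σ → ℕ) (F : MvPowerSeries σ A)

/-- `∑_r G r · F_r`, where `F_r` is the weight `r` component of `F`. -/
def componentSum (G : ℕ → MvPowerSeries σ A) : MvPowerSeries σ A :=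
  formalSum fun r : ℕ => G r * weightedHomogeneousComponent w r F

lemma componentSum_support (G : ℕ → MvPowerSeries σ A) (d : σ →₀ ℕ) {N : ℕ}
    (h : Finsupp.weight w d < N) :
    (Function.support fun r : ℕ => coeff d (G r * weightedHomogeneousComponent w r F)) ⊆
      Finset.range N := by
  intro r hr
  by_contra hr'
  simp only [Finset.coe_range, Set.mem_Iio, not_lt] at hr'
  exact hr (coeff_mul_component_eq_zero w (lt_of_lt_of_le h hr') _ _)

lemma coeff_componentSum (G : ℕ → MvPowerSeries σ A) (d : σ →₀ ℕ) {N : ℕ}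
    (h : Finsupp.weight w d < N) :
    coeff d (componentSum w F G) =
      coeff d (∑ r ∈ Finset.range N, G r * weightedHomogeneousComponent w r F) := by
  rw [map_sum]
  exact finsum_eq_sum_of_support_subset _ (componentSum_support w F G d h)

lemma componentSum_add (G H : ℕ → MvPowerSeries σ A) :
    componentSum w F (fun r => G r + H r) = componentSum w F G + componentSum w F H := by
  ext d
  rw [map_add, coeff_componentSum w F _ d (Nat.lt_succ_self _),
    coeff_componentSum w F _ d (Nat.lt_succ_self _),
    coeff_componentSum w F _ d (Nat.lt_succ_self _), ← map_add, ← Finset.sum_add_distrib]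
  simp only [add_mul]

lemma componentSum_sum {ι : Type*} (s : Finset ι) (G : ι → ℕ → MvPowerSeries σ A) :
    componentSum w F (fun r => ∑ i ∈ s, G i r) = ∑ i ∈ s, componentSum w F (G i) := by
  ext d
  rw [map_sum, coeff_componentSum w F _ d (Nat.lt_succ_self _)]
  simp only [fun i => coeff_componentSum w F (G i) d (Nat.lt_succ_self _), Finset.sum_mul]
  rw [← map_sum, Finset.sum_comm]

lemma componentSum_mul_left (H : MvPowerSeries σ A) (G : ℕ → MvPowerSeries σ A) :
    componentSum w F (fun r => H * G r) = H * componentSum w F G := by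
  classical
  ext d
  rw [coeff_componentSum w F _ d (Nat.lt_succ_self _)]
  simp only [mul_assoc]
  rw [← Finset.mul_sum, coeff_mul, coeff_mul]
  refine Finset.sum_congr rfl fun p hp => ?_
  rw [Finset.HasAntidiagonal.mem_antidiagonal] at hp
  rw [← coeff_componentSum w F G p.2]
  rw [← hp, map_add]
  omega

lemma componentSum_C (κ : ℕ → A) :
    componentSum w F (fun r => C (κ r)) = weightScale w κ F := formalSum_component w κ F

lemma map_componentSum {A' : Type*} [CommRing A'] (φ : A →+* A') (G : ℕ → MvPowerSeries σ A) :
    MvPowerSeries.map φ (componentSum w F G) =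
      componentSum w (MvPowerSeries.map φ F) fun r => MvPowerSeries.map φ (G r) := by
  ext d
  rw [coeff_map, coeff_componentSum w F _ d (Nat.lt_succ_self _),
    coeff_componentSum w _ _ d (Nat.lt_succ_self _), ← coeff_map, map_sum]
  simp only [map_mul, map_component]

lemma map_weightScale {A' : Type*} [CommRing A'] (φ : A →+* A') (κ : ℕ → A) :
    MvPowerSeries.map φ (weightScale w κ F) =
      weightScale w (fun r => φ (κ r)) (MvPowerSeries.map φ F) := by
  ext d
  rw [coeff_map, coeff_weightScale, coeff_weightScale, coeff_map, map_mul]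

lemma component_mul_of_weight_zero {G : MvPowerSeries σ A}
    (hG : weightedHomogeneousComponent w 0 G = G) (n : ℕ) :
    weightedHomogeneousComponent w n (G * F) = G * weightedHomogeneousComponent w n F := by
  rw [component_mul, Finset.sum_eq_single (0, n)]
  · rw [hG]
  · rintro ⟨a, b⟩ hab hne
    rw [Finset.HasAntidiagonal.mem_antidiagonal] at hab
    have ha : a ≠ 0 := by
      rintro rfl
      exact hne (by rw [← hab, zero_add])
    have : weightedHomogeneousComponent w a G = 0 := by
      rw [← hG]
      ext d
      rw [coeff_component, coeff_component]
      split_ifs with h1 h2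
      · exact absurd (h1.symm.trans h2) ha
      · simp
      · simp
    rw [this, zero_mul]
  · intro h
    exact absurd (Finset.HasAntidiagonal.mem_antidiagonal.2 (zero_add n)) h

end FormalSum

/-! ### The generating series of the parameters -/

/-- The weight in the parameters: `y_n` and `ũ_n` have weight `n`. -/
def wt : Par → ℕ
  | .y n => n
  | .ut n => n
  | .eps => 0

section Parameters

variable {A : Type*} [CommRing A]

/-- The series `∑_{n>0} κ_n y_n`; the value `κ 0` plays no role. -/
def ySeries (κ : ℕ → A) : MvPowerSeries Par A :=
  linearSeries fun
    | .y n => κ n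
    | .ut _ => 0
    | .eps => 0

/-- The series `∑_{n>0} κ_n ũ_n`; the value `κ 0` plays no role. -/
def utSeries (κ : ℕ → A) : MvPowerSeries Par A :=
  linearSeries fun
    | .y _ => 0
    | .ut n => κ n
    | .eps => 0

lemma weight_single (i : Par) : Finsupp.weight wt (Finsupp.single i 1) = wt i := by
  rw [Finsupp.weight_single, one_smul]

lemma weightScale_linearSeries (κ : ℕ → A) (c : Par → A) :
    weightScale wt κ (linearSeries c) = linearSeries fun i => κ (wt i) * c i :=
  eq_linearSeries
    (fun i => by rw [coeff_weightScale, coeff_linearSeries_single, weight_single])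
    fun d h => by rw [coeff_weightScale, coeff_linearSeries_of_ne _ d h, mul_zero]

lemma weightScale_ySeries (κ c : ℕ → A) :
    weightScale wt κ (ySeries c) = ySeries fun n => κ n * c n := by
  rw [ySeries, weightScale_linearSeries, ySeries]
  congr 1
  funext i
  cases i <;> simp [wt]

lemma weightScale_utSeries (κ c : ℕ → A) :
    weightScale wt κ (utSeries c) = utSeries fun n => κ n * c n := by
  rw [utSeries, weightScale_linearSeries, utSeries]
  congr 1
  funext i
  cases i <;> simp [wt]

lemma ySeries_add (c c' : ℕ → A) : ySeries (c + c') = ySeries c + ySeries c' := by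
  rw [ySeries, ySeries, ySeries, ← linearSeries_add]
  congr 1
  funext i
  cases i <;> simp

lemma utSeries_add (c c' : ℕ → A) : utSeries (c + c') = utSeries c + utSeries c' := by
  rw [utSeries, utSeries, utSeries, ← linearSeries_add]
  congr 1
  funext i
  cases i <;> simp

lemma C_mul_ySeries (a : A) (c : ℕ → A) : C a * ySeries c = ySeries fun n => a * c n := by
  rw [ySeries, C_mul_linearSeries, ySeries]
  congr 1
  funext i
  cases i <;> simp

lemma C_mul_utSeries (a : A) (c : ℕ → A) : C a * utSeries c = utSeries fun n => a * c n := by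
  rw [utSeries, C_mul_linearSeries, utSeries]
  congr 1
  funext i
  cases i <;> simp

lemma map_ySeries {A' : Type*} [CommRing A'] (φ : A →+* A') (c : ℕ → A) :
    MvPowerSeries.map φ (ySeries c) = ySeries fun n => φ (c n) := by
  rw [ySeries, map_linearSeries, ySeries]
  congr 1
  funext i
  cases i <;> simp

lemma map_utSeries {A' : Type*} [CommRing A'] (φ : A →+* A') (c : ℕ → A) :
    MvPowerSeries.map φ (utSeries c) = utSeries fun n => φ (c n) := by
  rw [utSeries, map_linearSeries, utSeries]
  congr 1
  funext i
  cases i <;> simp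

lemma constantCoeff_ySeries (c : ℕ → A) : constantCoeff (ySeries c) = 0 :=
  constantCoeff_linearSeries _

lemma constantCoeff_utSeries (c : ℕ → A) : constantCoeff (utSeries c) = 0 :=
  constantCoeff_linearSeries _

end Parameters

lemma component_linearSeries {A : Type*} [CommRing A] (n : ℕ) (c : Par → A) :
    weightedHomogeneousComponent wt n (linearSeries c) =
      linearSeries fun i => if wt i = n then c i else 0 :=
  eq_linearSeries
    (fun i => by rw [coeff_component, coeff_linearSeries_single, weight_single])
    fun d h => by rw [coeff_component, coeff_linearSeries_of_ne _ d h, ite_self]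

lemma X_eq_linearSeries {σ A : Type*} [CommRing A] [DecidableEq σ] (i : σ) :
    (X i : MvPowerSeries σ A) = linearSeries (Pi.single i 1) :=
  eq_linearSeries
    (fun j => by
      rw [coeff_X, Pi.single_apply]
      exact if_congr (Finsupp.single_left_inj one_ne_zero) rfl rfl)
    fun d h => by rw [coeff_X, if_neg (h i)]

lemma linearSeries_zero {σ A : Type*} [CommRing A] :
    linearSeries (fun _ : σ => (0 : A)) = 0 :=
  (eq_linearSeries (fun _ => map_zero _) fun _ _ => map_zero _).symm

/-- `y_n` is the weight `n` component of `∑ y_n`. -/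
lemma y_eq_component (n : ℕ) : y n = weightedHomogeneousComponent wt n (ySeries fun _ => 1) := by
  classical
  rw [y, ySeries, component_linearSeries]
  split_ifs with h
  · rw [X_eq_linearSeries]
    congr 1
    funext i
    cases i with
    | y m =>
      have : (Par.y m = Par.y ⟨n, h⟩) ↔ (m : ℕ) = n :=
        ⟨fun e => congrArg PNat.val (Par.y.inj e), fun e => congrArg Par.y (PNat.eq e)⟩
      rw [Pi.single_apply]
      change _ = if (m : ℕ) = n then (1 : MvPolynomial Var ℂ) else 0
      split_ifs <;> tauto
    | ut m => simp
    | eps => simp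
  · have hn : n = 0 := by omega
    subst hn
    rw [← linearSeries_zero]
    congr 1
    funext i
    cases i <;> simp [wt]

/-- `ũ_n` is the weight `n` component of `∑ ũ_n`. -/
lemma ut_eq_component (n : ℕ) :
    ut n = weightedHomogeneousComponent wt n (utSeries fun _ => 1) := by
  classical
  rw [ut, utSeries, component_linearSeries]
  split_ifs with h
  · rw [X_eq_linearSeries]
    congr 1
    funext i
    cases i with
    | ut m =>
      have : (Par.ut m = Par.ut ⟨n, h⟩) ↔ (m : ℕ) = n :=
        ⟨fun e => congrArg PNat.val (Par.ut.inj e), fun e => congrArg Par.ut (PNat.eq e)⟩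
      rw [Pi.single_apply]
      change _ = if (m : ℕ) = n then (1 : MvPolynomial Var ℂ) else 0
      split_ifs <;> tauto
    | y m => simp
    | eps => simp
  · have hn : n = 0 := by omega
    subst hn
    rw [← linearSeries_zero]
    congr 1
    funext i
    cases i <;> simp [wt]

/-! ### Symbols on exponentials -/

/-- The value of a symbol on a pair of exponentials whose linear forms differ by `∑ v_i X_i`:
each `D_i` becomes the number `v i`. -/
def evalSym (v : Var → ℂ) : Sym →ₐ[ℂ] MvPowerSeries Par ℂ :=
  mapAlgHom (MvPolynomial.aeval v)

lemma evalSym_apply (v : Var → ℂ) (P : Sym) :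
    evalSym v P = MvPowerSeries.map
      ((MvPolynomial.aeval v : MvPolynomial Var ℂ →ₐ[ℂ] ℂ) : MvPolynomial Var ℂ →+* ℂ) P := rfl

lemma hirotaD_expLin (L M : Var → ℂ) (v : Var) :
    hirotaD v (expLin L ⊗ₜ[ℂ] expLin M) = (L v - M v) • (expLin L ⊗ₜ[ℂ] expLin M) := by
  rw [hirotaD, LinearMap.sub_apply, LinearMap.rTensor_tmul, LinearMap.lTensor_tmul,
    Derivation.coeFn_coe, pderiv_expLin, pderiv_expLin, TensorProduct.tmul_smul,
    ← TensorProduct.smul_tmul']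
  exact (sub_smul (L v) (M v) (expLin L ⊗ₜ[ℂ] expLin M)).symm

/-- A Hirota polynomial acts on a pair of exponentials by evaluation at the difference of their
linear forms. -/
lemma hirotaPoly_expLin (P : MvPolynomial Var ℂ) (L M : Var → ℂ) :
    hirotaPoly P (expLin L) (expLin M) =
      MvPolynomial.aeval (L - M) P • expLin (L + M) := by
  have h : ∀ m : Multiset Var,
      m.foldr (fun v t => hirotaD v t) (expLin L ⊗ₜ[ℂ] expLin M) =
        (m.map (L - M)).prod • (expLin L ⊗ₜ[ℂ] expLin M) := by
    intro m
    induction m using Multiset.induction_on with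
    | empty => simp
    | cons v m ih =>
      rw [Multiset.foldr_cons, ih, map_smul, hirotaD_expLin, smul_smul, Multiset.map_cons,
        Multiset.prod_cons, mul_comm]
      rfl
  rw [hirotaPoly]
  simp only [h, smul_smul]
  rw [← Finset.sum_smul, map_smul, LinearMap.mul'_apply, ← expLin_add, MvPolynomial.aeval_def,
    MvPolynomial.eval₂_eq]
  congr 1
  refine Finset.sum_congr rfl fun d _ => ?_
  rw [Finsupp.toMultiset_map, Finsupp.prod_toMultiset,
    Finsupp.prod_mapDomain_index (fun _ => pow_zero _) (fun _ _ _ => pow_add _ _ _)]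
  rfl

lemma coeff_hirota_expLin (P : Sym) (L M : Var → ℂ) (d : Par →₀ ℕ) :
    coeff d (hirota P (expLin L) (expLin M)) =
      coeff d (evalSym (L - M) P) • expLin (L + M) :=
  hirotaPoly_expLin _ L M

/-! ### The values of the operators of the system -/

/-- The symbol `D_{x_n}` as a polynomial, with `D_{x_0} = 0`. -/
def dxPoly (n : ℕ) : MvPolynomial Var ℂ :=
  if h : 0 < n then MvPolynomial.X (Var.x ⟨n, h⟩) else 0

/-- The symbol `D_{u_n}` as a polynomial, with `D_{u_0} = 0`. -/
def duPoly (n : ℕ) : MvPolynomial Var ℂ :=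
  if h : 0 < n then MvPolynomial.X (Var.u ⟨n, h⟩) else 0

lemma Dx_eq (n : ℕ) : Dx n = C (dxPoly n) := by
  rw [Dx, dxPoly]
  split_ifs
  · rfl
  · exact (map_zero C).symm

lemma Du_eq (n : ℕ) : Du n = C (duPoly n) := by
  rw [Du, duPoly]
  split_ifs
  · rfl
  · exact (map_zero C).symm

/-- The value of `D_{x_n}`. -/
def xVal (v : Var → ℂ) (n : ℕ) : ℂ := MvPolynomial.aeval v (dxPoly n)

/-- The value of `D_{u_n}`. -/
def uVal (v : Var → ℂ) (n : ℕ) : ℂ := MvPolynomial.aeval v (duPoly n)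

lemma formalSum_y_mul (κ : ℕ → MvPolynomial Var ℂ) :
    (formalSum fun n : ℕ => y n * C (κ n)) = ySeries κ := by
  have := formalSum_component wt κ (ySeries fun _ => (1 : MvPolynomial Var ℂ))
  rw [weightScale_ySeries] at this
  simpa only [mul_comm (C _), ← y_eq_component, mul_one] using this

lemma formalSum_ut_mul (κ : ℕ → MvPolynomial Var ℂ) :
    (formalSum fun n : ℕ => ut n * C (κ n)) = utSeries κ := by
  have := formalSum_component wt κ (utSeries fun _ => (1 : MvPolynomial Var ℂ))
  rw [weightScale_utSeries] at this
  simpa only [mul_comm (C _), ← ut_eq_component, mul_one] using this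

lemma formalSum_natCast_mul_y (r : ℕ) :
    (formalSum fun k : ℕ => (k : Sym) * y k * Dx (r + k)) =
      ySeries fun k => (k : MvPolynomial Var ℂ) * dxPoly (r + k) := by
  rw [← formalSum_y_mul]
  congr 1
  funext k
  rw [Dx_eq, map_mul, map_natCast]
  ring

/-- The summation index is shifted by `r`; the summands with `k ≤ r` vanish. -/
lemma formalSum_natCast_mul_ut (r : ℕ) :
    (formalSum fun k : ℕ => ((k - r : ℕ) : Sym) * ut (k - r) * Du k) =
      utSeries fun j => (j : MvPolynomial Var ℂ) * duPoly (r + j) := by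
  have h1 : (utSeries fun j => (j : MvPolynomial Var ℂ) * duPoly (r + j)) =
      weightScale wt (fun j => (j : MvPolynomial Var ℂ) * duPoly (r + j))
        (utSeries fun _ => 1) := by
    rw [weightScale_utSeries]
    simp only [mul_one]
  have h2 : ∀ k, ((k - r : ℕ) : Sym) * ut (k - r) * Du k =
      C (((k - r : ℕ) : MvPolynomial Var ℂ) * duPoly k) *
        weightedHomogeneousComponent wt (k - r) (utSeries fun _ => 1) := by
    intro k
    rw [Du_eq, ← ut_eq_component, map_mul, map_natCast]
    ring
  rw [h1]
  simp only [h2]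
  ext1 d
  change ∑ᶠ k : ℕ, coeff d (C (((k - r : ℕ) : MvPolynomial Var ℂ) * duPoly k) *
    weightedHomogeneousComponent wt (k - r) (utSeries fun _ => 1)) = _
  rw [finsum_eq_single _ (r + Finsupp.weight wt d)]
  · rw [Nat.add_sub_cancel_left, coeff_C_mul, coeff_component, if_pos rfl, coeff_weightScale]
  · intro k hk
    rw [coeff_C_mul, coeff_component]
    by_cases h : k - r = 0
    · rw [h]
      simp
    · rw [if_neg (by omega), mul_zero]

/-- `exp((ε - W) ∑ ũ_n)`, whose weight `r` component is the value of `S_r((ε - D_w) ũ)`. -/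
def uExp (W : ℂ) : MvPowerSeries Par ℂ :=
  fexp ((X Par.eps - C W) * utSeries fun _ => 1)

/-- `exp(c ∑ y_n)`, whose weight `r` component is `S_r(c y)`. -/
def yExp (c : ℂ) : MvPowerSeries Par ℂ := fexp (ySeries fun _ => c)

lemma component_zero_linearSeries {A : Type*} [CommRing A] {c : Par → A} (hc : c .eps = 0) :
    weightedHomogeneousComponent wt 0 (linearSeries c) = 0 := by
  rw [component_linearSeries, ← linearSeries_zero]
  congr 1
  funext i
  cases i <;> simp [wt, hc]

lemma component_zero_eps_sub {A : Type*} [CommRing A] (a : A) :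
    weightedHomogeneousComponent wt 0 (X Par.eps - C a) = X Par.eps - C a := by
  classical
  ext d
  rw [coeff_component]
  split_ifs with h
  · rfl
  · rw [map_sub, coeff_X, coeff_C, if_neg, if_neg, sub_zero]
    · rintro rfl
      exact h (map_zero _)
    · rintro rfl
      exact h (weight_single _)

lemma component_eps_sub_mul_utSeries {A : Type*} [CommRing A] (a : A) (n : ℕ) :
    weightedHomogeneousComponent wt n ((X Par.eps - C a) * utSeries fun _ => 1) =
      (X Par.eps - C a) * weightedHomogeneousComponent wt n (utSeries fun _ => 1) :=
  component_mul_of_weight_zero wt _ (component_zero_eps_sub a) n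

lemma constantCoeff_mul_utSeries {A : Type*} [CommRing A] (F : MvPowerSeries Par A) (c : ℕ → A) :
    constantCoeff (F * utSeries c) = 0 := by
  rw [map_mul, constantCoeff_utSeries, mul_zero]

lemma Su_eq (r : ℕ) : Su r = weightedHomogeneousComponent wt r
    (fexp ((X Par.eps - C (MvPolynomial.X Var.w)) * utSeries fun _ => 1)) := by
  refine schur_eq_component wt (fun j _ => ?_) ?_ r
  · rw [component_eps_sub_mul_utSeries, ← ut_eq_component]
    rfl
  · rw [component_eps_sub_mul_utSeries, utSeries, component_zero_linearSeries rfl, mul_zero]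

lemma evalSym_C (v : Var → ℂ) (a : MvPolynomial Var ℂ) :
    evalSym v (C a) = C (MvPolynomial.aeval v a) := by
  rw [evalSym_apply, map_C]
  rfl

lemma evalSym_uExp (v : Var → ℂ) :
    evalSym v (fexp ((X Par.eps - C (MvPolynomial.X Var.w)) * utSeries fun _ => 1)) =
      uExp (v .w) := by
  rw [evalSym_apply, map_fexp _ (constantCoeff_mul_utSeries _ _), map_mul, map_utSeries, map_sub,
    map_X, map_C, uExp]
  simp

lemma schur_y (σ : ℤ) (k : ℕ) :
    schur (fun n => 2 * (σ : Sym) * y n) k =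
      weightedHomogeneousComponent wt k (fexp (ySeries fun _ => 2 * (σ : MvPolynomial Var ℂ))) := by
  have h : (ySeries fun _ => 2 * (σ : MvPolynomial Var ℂ)) =
      C (2 * (σ : MvPolynomial Var ℂ)) * ySeries fun _ => 1 := by
    rw [C_mul_ySeries]
    simp only [mul_one]
  have h' : ∀ n, weightedHomogeneousComponent wt n (ySeries fun _ => 2 * (σ : MvPolynomial Var ℂ)) =
      2 * (σ : Sym) * y n := by
    intro n
    rw [h, ← smul_eq_C_mul, map_smul, smul_eq_C_mul, ← y_eq_component, map_mul, map_ofNat,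
      map_intCast]
  exact schur_eq_component wt (fun j _ => (h' j).symm)
    (component_zero_linearSeries rfl) k

lemma evalSym_expD (v : Var → ℂ) :
    evalSym v expD = fexp (ySeries (xVal v)) * fexp (utSeries (uVal v)) := by
  rw [expD]
  simp only [Dx_eq, Du_eq, formalSum_y_mul, formalSum_ut_mul]
  rw [map_mul, evalSym_apply, evalSym_apply, map_fexp _ (constantCoeff_ySeries _),
    map_fexp _ (constantCoeff_utSeries _), map_ySeries, map_utSeries]
  rfl

lemma evalSym_cartanPart (v : Var → ℂ) (p : ℤ) :
    evalSym v (cartanPart p) = C ((p : ℂ) ^ 2) +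
      componentSum wt (uExp (v .w)) fun r =>
        C (2 * (p : ℂ) * xVal v r +
          ∑ jk ∈ Finset.HasAntidiagonal.antidiagonal r, xVal v jk.1 * xVal v jk.2) +
        2 * (ySeries fun k => (k : ℂ) * xVal v (r + k)) +
        2 * (utSeries fun j => (j : ℂ) * uVal v (r + j)) := by
  rw [cartanPart]
  simp only [formalSum_natCast_mul_y, formalSum_natCast_mul_ut, Su_eq]
  rw [map_add, map_pow, map_intCast, map_pow, map_intCast]
  congr 1
  rw [← evalSym_uExp]
  refine (map_componentSum wt _ _ _).trans ?_
  congr 1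
  funext r
  rw [← evalSym_apply]
  simp only [map_add, map_mul, map_sum, map_ofNat, map_intCast, Dx_eq, evalSym_C]
  rw [evalSym_apply, evalSym_apply, map_ySeries, map_utSeries]
  simp [xVal, uVal]

lemma evalSym_rootPart (v : Var → ℂ) (σ p : ℤ) :
    evalSym v (rootPart σ p) =
      weightScale wt (fun r => schur (fun n => (-2 * (σ : ℂ)) * (n : ℂ)⁻¹ * xVal v n)
        ((r : ℤ) - 2 + 2 * σ * p)) (uExp (v .w) * yExp (2 * σ)) := by
  have hC : ∀ (c : ℕ → ℂ) (m : ℤ), schur (fun n => c n • Dx n) m =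
      C (schur (fun n => c n • dxPoly n) m) := by
    intro c m
    have := map_schur (IsScalarTower.toAlgHom ℂ (MvPolynomial Var ℂ) Sym)
      (fun n => c n • dxPoly n) m
    simp only [map_smul, IsScalarTower.coe_toAlgHom', MvPowerSeries.algebraMap_apply,
      Algebra.algebraMap_self, RingHom.id_apply, ← Dx_eq] at this
    exact this.symm
  rw [rootPart]
  simp only [Su_eq, schur_y, hC, ← Finset.sum_mul, ← component_mul]
  simp only [mul_comm (weightedHomogeneousComponent _ _ _)]
  rw [formalSum_component, evalSym_apply, map_weightScale, map_mul, ← evalSym_apply, evalSym_uExp,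
    map_fexp _ (constantCoeff_ySeries _), map_ySeries]
  refine congrArg₂ (fun κ F => weightScale wt κ F) (funext fun r => ?_)
    (congrArg₂ (fun F G => F * G) rfl (congrArg (fun c => fexp (ySeries c)) (funext fun _ => ?_)))
  · refine (map_schur (MvPolynomial.aeval v : MvPolynomial Var ℂ →ₐ[ℂ] ℂ) _ _).trans ?_
    simp only [map_smul, smul_eq_mul]
    rfl
  · simp

/-! ### Residues of rational functions with double poles -/

section Residue

/-- The Laurent series of the coordinate `ζ` in the local parameter `ζ⁻¹` at infinity. -/
def zetaInf : LaurentSeries ℂ := HahnSeries.single (-1) 1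

lemma ofPowerSeries_one_sub (z : ℂ) :
    HahnSeries.ofPowerSeries ℤ ℂ (1 - PowerSeries.C z * PowerSeries.X) =
      HahnSeries.single 1 1 * (zetaInf - HahnSeries.C z) := by
  rw [mul_sub, zetaInf, HahnSeries.single_mul_single, map_sub, map_one, map_mul,
    HahnSeries.ofPowerSeries_C, HahnSeries.ofPowerSeries_X, mul_comm (HahnSeries.C z)]
  simp

lemma zetaInf_sub_inv (z : ℂ) : ∃ P : PowerSeries ℂ, PowerSeries.coeff 0 P = 1 ∧
    (zetaInf - HahnSeries.C z)⁻¹ =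
      HahnSeries.single 1 1 * HahnSeries.ofPowerSeries ℤ ℂ P := by
  have hc : PowerSeries.constantCoeff (1 - PowerSeries.C z * PowerSeries.X) ≠ 0 := by simp
  refine ⟨(1 - PowerSeries.C z * PowerSeries.X)⁻¹, ?_, ?_⟩
  · simp
  · refine inv_eq_of_mul_eq_one_right ?_
    rw [← mul_assoc, mul_comm (zetaInf - HahnSeries.C z), ← ofPowerSeries_one_sub, ← map_mul,
      PowerSeries.mul_inv_cancel _ hc, map_one]

lemma zetaInf_sub_ne_zero (z : ℂ) : zetaInf - HahnSeries.C z ≠ 0 := by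
  intro h
  have := ofPowerSeries_one_sub z
  rw [h, mul_zero] at this
  have h1 := congrArg (fun f => f.coeff ((0 : ℕ) : ℤ)) this
  rw [LaurentSeries.coeff_coe_powerSeries] at h1
  simp at h1

lemma coeff_inv_zetaInf_sub (z : ℂ) : (zetaInf - HahnSeries.C z)⁻¹.coeff 1 = 1 := by
  obtain ⟨P, hP, h⟩ := zetaInf_sub_inv z
  rw [h, HahnSeries.coeff_single_mul, sub_self, one_mul, ← hP]
  exact LaurentSeries.coeff_coe_powerSeries P 0

lemma coeff_inv_zetaInf_sub_sq (z : ℂ) : ((zetaInf - HahnSeries.C z)⁻¹ ^ 2).coeff 1 = 0 := by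
  obtain ⟨P, hP, h⟩ := zetaInf_sub_inv z
  rw [h, mul_pow, HahnSeries.single_pow, ← map_pow, HahnSeries.coeff_single_mul,
    PowerSeries.coeff_coe]
  simp

/-- The expansion of a polynomial at infinity. -/
def polyInf : Polynomial ℂ →+* LaurentSeries ℂ := Polynomial.eval₂RingHom HahnSeries.C zetaInf

lemma coeff_polyInf (q : Polynomial ℂ) : (polyInf q).coeff 1 = 0 := by
  induction q using Polynomial.induction_on' with
  | add p q hp hq => rw [map_add, HahnSeries.coeff_add, hp, hq, add_zero]
  | monomial n a =>
    rw [polyInf, Polynomial.coe_eval₂RingHom, Polynomial.eval₂_monomial, zetaInf,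
      HahnSeries.single_pow, mul_comm, HahnSeries.coeff_single_mul, one_pow, one_mul,
      HahnSeries.C_apply, HahnSeries.coeff_single_of_ne]
    simp
    omega

variable {ι : Type*} [DecidableEq ι]

/-- The derivative of a product of squares, in logarithmic form. -/
lemma eval_derivative_prod_sq (s : Finset ι) (z : ι → ℂ) (x : ℂ) (hx : ∀ i ∈ s, x ≠ z i) :
    (Polynomial.derivative (∏ i ∈ s, (Polynomial.X - Polynomial.C (z i)) ^ 2)).eval x =
      (∏ i ∈ s, (x - z i) ^ 2) * ∑ i ∈ s, 2 / (x - z i) := by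
  induction s using Finset.induction_on with
  | empty => simp
  | insert i s hi ih =>
    have hi' : x - z i ≠ 0 := sub_ne_zero.2 (hx i (Finset.mem_insert_self _ _))
    rw [Finset.prod_insert hi, Polynomial.derivative_mul, Polynomial.eval_add,
      Polynomial.eval_mul, Polynomial.eval_mul, ih fun j hj => hx j (Finset.mem_insert_of_mem hj),
      Finset.prod_insert hi, Finset.sum_insert hi, Polynomial.eval_prod]
    simp only [Polynomial.eval_pow, Polynomial.eval_sub, Polynomial.eval_X, Polynomial.eval_C,
      Polynomial.derivative_X_sub_C_sq, Polynomial.eval_mul]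
    field_simp

/-- The residue at infinity of `f / ∏ (ζ - z_i)²` is the sum of the residues at the double
poles. -/
lemma coeff_polyInf_div (s : Finset ι) (z : ι → ℂ) (hz : Function.Injective z)
    (f : Polynomial ℂ) :
    (polyInf f * ∏ i ∈ s, (zetaInf - HahnSeries.C (z i))⁻¹ ^ 2).coeff 1 =
      ∑ j ∈ s, (f.derivative.eval (z j) - f.eval (z j) * ∑ i ∈ s.erase j, 2 / (z j - z i)) *
        (∏ i ∈ s.erase j, (z j - z i) ^ 2)⁻¹ := by
  obtain ⟨q, r, hr, hf⟩ := Polynomial.eq_quo_mul_prod_pow_add_sum_rem_mul_prod_pow (s := s) f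
    (g := fun i => Polynomial.X - Polynomial.C (z i)) (fun i _ => Polynomial.monic_X_sub_C _)
    (fun i _ j _ hij => Polynomial.isCoprime_X_sub_C_of_isUnit_sub
      (sub_ne_zero.2 (hz.ne hij)).isUnit) (fun _ => 2)
  have hconst : ∀ i ∈ s, ∀ j, r i j = Polynomial.C ((r i j).coeff 0) := by
    intro i hi j
    refine Polynomial.eq_C_of_degree_le_zero ?_
    have := hr i hi j
    rw [Polynomial.degree_X_sub_C] at this
    exact Nat.WithBot.lt_one_iff_le_zero.1 this
  set a : ι → ℂ := fun i => (r i 0).coeff 0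
  set b : ι → ℂ := fun i => (r i 1).coeff 0
  have hf' : f = q * (∏ i ∈ s, (Polynomial.X - Polynomial.C (z i)) ^ 2) +
      ∑ i ∈ s, (Polynomial.C (a i) + Polynomial.C (b i) * (Polynomial.X - Polynomial.C (z i))) *
        ∏ k ∈ s.erase i, (Polynomial.X - Polynomial.C (z k)) ^ 2 := by
    conv_lhs => rw [hf]
    congr 1
    refine Finset.sum_congr rfl fun i hi => ?_
    rw [Fin.sum_univ_two, hconst i hi 0, hconst i hi 1]
    simp only [a, b]
    simp
    ring
  have hpoly : ∀ i, polyInf (Polynomial.X - Polynomial.C (z i)) = zetaInf - HahnSeries.C (z i) := by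
    intro i
    simp [polyInf]
  have hleft : polyInf f * ∏ i ∈ s, (zetaInf - HahnSeries.C (z i))⁻¹ ^ 2 =
      polyInf q + ∑ i ∈ s, (HahnSeries.C (a i) * (zetaInf - HahnSeries.C (z i))⁻¹ ^ 2 +
        HahnSeries.C (b i) * (zetaInf - HahnSeries.C (z i))⁻¹) := by
    conv_lhs => rw [hf']
    rw [map_add, map_mul, map_prod, map_sum, add_mul, mul_assoc, ← Finset.prod_mul_distrib,
      Finset.sum_mul]
    congr 1
    · rw [Finset.prod_eq_one, mul_one]
      intro i _
      rw [map_pow, hpoly, ← mul_pow, mul_inv_cancel₀ (zetaInf_sub_ne_zero _), one_pow]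
    · refine Finset.sum_congr rfl fun i hi => ?_
      rw [← Finset.mul_prod_erase s _ hi, map_mul, map_prod]
      have h1 : (∏ k ∈ s.erase i, polyInf ((Polynomial.X - Polynomial.C (z k)) ^ 2)) *
          ∏ k ∈ s.erase i, (zetaInf - HahnSeries.C (z k))⁻¹ ^ 2 = 1 := by
        rw [← Finset.prod_mul_distrib, Finset.prod_eq_one]
        intro k _
        rw [map_pow, hpoly, ← mul_pow, mul_inv_cancel₀ (zetaInf_sub_ne_zero _), one_pow]
      have h2 := mul_inv_cancel₀ (zetaInf_sub_ne_zero (z i))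
      have h3 : ∀ c, polyInf (Polynomial.C c) = HahnSeries.C c := fun c => by simp [polyInf]
      rw [map_add, map_mul, hpoly, h3, h3]
      generalize (zetaInf - HahnSeries.C (z i)) = A at h2
      linear_combination (HahnSeries.C (a i) + HahnSeries.C (b i) * A) * A⁻¹ ^ 2 * h1 +
        HahnSeries.C (b i) * A⁻¹ * h2
  rw [hleft, HahnSeries.coeff_add, coeff_polyInf, zero_add, HahnSeries.coeff_sum]
  refine Finset.sum_congr rfl fun j hj => ?_
  rw [HahnSeries.coeff_add, HahnSeries.C_mul_eq_smul, HahnSeries.C_mul_eq_smul,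
    HahnSeries.coeff_smul, HahnSeries.coeff_smul, coeff_inv_zetaInf_sub, coeff_inv_zetaInf_sub_sq,
    smul_zero, zero_add, smul_eq_mul, mul_one]
  have hne : ∀ i ∈ s.erase j, z j ≠ z i := fun i hi => hz.ne (Finset.ne_of_mem_erase hi).symm
  set H := ∏ i ∈ s.erase j, (Polynomial.X - Polynomial.C (z i)) ^ 2 with hH
  have hH0 : H.eval (z j) = ∏ i ∈ s.erase j, (z j - z i) ^ 2 := by
    rw [hH, Polynomial.eval_prod]
    simp
  have hH1 : H.derivative.eval (z j) = H.eval (z j) * ∑ i ∈ s.erase j, 2 / (z j - z i) := by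
    rw [hH0, hH, eval_derivative_prod_sq _ _ _ hne]
  have hHne : H.eval (z j) ≠ 0 := by
    rw [hH0]
    exact Finset.prod_ne_zero_iff.2 fun i hi => pow_ne_zero _ (sub_ne_zero.2 (hne i hi))
  -- All summands of `f` but the one of index `j` are divisible by `(X - z_j)²`.
  obtain ⟨g, hg⟩ : ∃ g, f = g * (Polynomial.X - Polynomial.C (z j)) ^ 2 +
      (Polynomial.C (a j) + Polynomial.C (b j) * (Polynomial.X - Polynomial.C (z j))) * H := by
    refine ⟨q * (∏ i ∈ s.erase j, (Polynomial.X - Polynomial.C (z i)) ^ 2) +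
      ∑ i ∈ s.erase j,
        (Polynomial.C (a i) + Polynomial.C (b i) * (Polynomial.X - Polynomial.C (z i))) *
        ∏ k ∈ (s.erase i).erase j, (Polynomial.X - Polynomial.C (z k)) ^ 2, ?_⟩
    conv_lhs => rw [hf']
    rw [← Finset.mul_prod_erase s _ hj, ← Finset.add_sum_erase s _ hj]
    have : ∀ i ∈ s.erase j,
        (Polynomial.C (a i) + Polynomial.C (b i) * (Polynomial.X - Polynomial.C (z i))) *
        ∏ k ∈ s.erase i, (Polynomial.X - Polynomial.C (z k)) ^ 2 =
        (Polynomial.C (a i) + Polynomial.C (b i) * (Polynomial.X - Polynomial.C (z i))) *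
        (∏ k ∈ (s.erase i).erase j, (Polynomial.X - Polynomial.C (z k)) ^ 2) *
          (Polynomial.X - Polynomial.C (z j)) ^ 2 := by
      intro i hi
      rw [← Finset.mul_prod_erase (s.erase i) _
        (Finset.mem_erase.2 ⟨(Finset.ne_of_mem_erase hi).symm, hj⟩)]
      ring
    rw [Finset.sum_congr rfl this, ← Finset.sum_mul]
    ring
  have e0 : f.eval (z j) = a j * H.eval (z j) := by
    rw [hg]
    simp
  have e1 : f.derivative.eval (z j) = b j * H.eval (z j) + a j * H.derivative.eval (z j) := by
    rw [hg]
    simp [Polynomial.derivative_mul, Polynomial.derivative_X_sub_C_sq]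
  rw [← hH0, e1, e0, hH1]
  field_simp
  ring

end Residue

/-! ### The Schur polynomials at power sums -/

lemma powerSeries_pderiv_fexp {F : PowerSeries ℂ} (hF : PowerSeries.constantCoeff F = 0) :
    PowerSeries.derivative ℂ (fexp (σ := Unit) F) =
      fexp (σ := Unit) F * PowerSeries.derivative ℂ F :=
  pderiv_fexp (σ := Unit) () hF

/-- The series `-∑ (z X)ⁿ / n = log (1 - z X)`. -/
def logSeries (z : ℂ) : PowerSeries ℂ := PowerSeries.mk fun n => -(n : ℂ)⁻¹ * z ^ n

lemma constantCoeff_logSeries (z : ℂ) : PowerSeries.constantCoeff (logSeries z) = 0 := by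
  rw [← PowerSeries.coeff_zero_eq_constantCoeff_apply, logSeries, PowerSeries.coeff_mk]
  simp

lemma fexp_logSeries (z : ℂ) :
    fexp (σ := Unit) (logSeries z) = 1 - PowerSeries.C z * PowerSeries.X := by
  set f : PowerSeries ℂ := fexp (σ := Unit) (logSeries z) with hf
  set u : PowerSeries ℂ := 1 - PowerSeries.C z * PowerSeries.X with hu
  have hu0 : PowerSeries.constantCoeff u ≠ 0 := by simp [hu]
  set g := u⁻¹ with hg
  have hgu : u * g = 1 := PowerSeries.mul_inv_cancel _ hu0
  have hgmk : g = PowerSeries.mk fun n => z ^ n := by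
    have : u * (PowerSeries.mk fun n => z ^ n) = 1 := by
      ext n
      rw [hu, sub_mul, one_mul, map_sub, mul_assoc, PowerSeries.coeff_C_mul, PowerSeries.coeff_mk,
        PowerSeries.coeff_one]
      cases n with
      | zero => simp
      | succ n =>
        rw [PowerSeries.coeff_succ_X_mul, PowerSeries.coeff_mk]
        simp [pow_succ']
    calc g = g * (u * PowerSeries.mk fun n => z ^ n) := by rw [this, mul_one]
      _ = PowerSeries.mk fun n => z ^ n := by rw [← mul_assoc, mul_comm g, hgu, one_mul]
  have hDL : PowerSeries.derivative ℂ (logSeries z) = -(PowerSeries.C z * g) := by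
    ext n
    rw [PowerSeries.coeff_derivative, logSeries, PowerSeries.coeff_mk, map_neg, hgmk,
      PowerSeries.coeff_C_mul, PowerSeries.coeff_mk]
    have : (n : ℂ) + 1 ≠ 0 := by exact_mod_cast Nat.succ_ne_zero n
    push_cast
    field_simp
    rw [pow_succ']
  have hDu : PowerSeries.derivative ℂ u = -PowerSeries.C z := by
    rw [hu, map_sub, Derivation.leibniz]
    simp
  have hDg : PowerSeries.derivative ℂ g = PowerSeries.C z * g ^ 2 := by
    rw [hg, PowerSeries.derivative_inv', hDu]
    ring
  have hfg : f * g = 1 := by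
    refine PowerSeries.derivative.ext ?_ ?_
    · rw [Derivation.leibniz, hf, powerSeries_pderiv_fexp (constantCoeff_logSeries z), ← hf, hDL,
        hDg, Derivation.map_one_eq_zero, smul_eq_mul, smul_eq_mul]
      ring
    · have h1 : PowerSeries.constantCoeff f = 1 :=
        constantCoeff_fexp (σ := Unit) (constantCoeff_logSeries z)
      rw [map_mul, h1, map_one, one_mul, hgmk, ← PowerSeries.coeff_zero_eq_constantCoeff_apply,
        PowerSeries.coeff_mk, pow_zero]
  calc f = f * (u * g) := by rw [hgu, mul_one]
    _ = (f * g) * u := by ring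
    _ = u := by rw [hfg, one_mul]

/-- The exponent `2 e` for `e = -1, 0, 1`. -/
lemma ofPowerSeries_fexp_logSeries {e : ℤ} (he : e = -1 ∨ e = 0 ∨ e = 1) (z : ℂ) :
    HahnSeries.ofPowerSeries ℤ ℂ (fexp (σ := Unit) ((2 * e : ℂ) • logSeries z)) =
      (HahnSeries.single 1 1 * (zetaInf - HahnSeries.C z)) ^ (2 * e) := by
  have h0 := constantCoeff_logSeries z
  have h2 : fexp (σ := Unit) (logSeries z + logSeries z) =
      (1 - PowerSeries.C z * PowerSeries.X) ^ 2 := by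
    rw [fexp_add (σ := Unit) h0 h0, fexp_logSeries, sq]
  have hs : constantCoeff (σ := Unit) (logSeries z + logSeries z) = 0 := by
    change PowerSeries.constantCoeff _ = 0
    rw [map_add, h0, add_zero]
  rcases he with rfl | rfl | rfl
  · have h3 : fexp (σ := Unit) (-(logSeries z + logSeries z)) *
        fexp (σ := Unit) (logSeries z + logSeries z) = 1 := by
      rw [← fexp_add (σ := Unit) (by rw [map_neg, hs, neg_zero]) hs, neg_add_cancel]
      exact fexp_zero (σ := Unit)
    have h4 : ((2 * (-1 : ℤ) : ℂ)) • logSeries z = -(logSeries z + logSeries z) := by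
      rw [← two_smul ℂ, ← neg_smul]
      norm_num
    have h5 := congrArg (HahnSeries.ofPowerSeries ℤ ℂ) h3
    rw [h2] at h5
    rw [h4, ← ofPowerSeries_one_sub]
    refine (eq_inv_of_mul_eq_one_left ((map_mul (HahnSeries.ofPowerSeries ℤ ℂ) _ _).symm.trans
      (h5.trans (map_one _)))).trans ?_
    rw [map_pow]
    exact (zpow_neg _ 2).symm
  · have h4 : ((2 * (0 : ℤ) : ℂ)) • logSeries z = 0 := by simp
    rw [h4]
    simp only [mul_zero, zpow_zero]
    exact (congrArg _ (fexp_zero (σ := Unit))).trans (map_one _)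
  · have h4 : ((2 * (1 : ℤ) : ℂ)) • logSeries z = logSeries z + logSeries z := by
      rw [← two_smul ℂ]
      norm_num
    rw [h4, h2, ← ofPowerSeries_one_sub, map_pow]
    rfl

section PowerSums

variable {ι : Type*} [DecidableEq ι] [Fintype ι]

/-- The Schur polynomials at the power sums of points `z_i` with multiplicities `-2 e_i` are the
coefficients at infinity of the rational function `∏ (ζ - z_i)^{2 e_i}`. -/
lemma schur_powerSum (e : ι → ℤ) (he : ∀ i, e i = -1 ∨ e i = 0 ∨ e i = 1) (z : ι → ℂ)
    (x : ℕ → ℂ) (hx : ∀ n, 0 < n → x n = ∑ i, (e i : ℂ) * z i ^ n) (m : ℤ) :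
    schur (fun n => -2 * (n : ℂ)⁻¹ * x n) (m + 2 * ∑ i, e i) =
      (∏ i, (zetaInf - HahnSeries.C (z i)) ^ (2 * e i)).coeff m := by
  have hmk : (PowerSeries.mk fun j : ℕ => if j = 0 then (0 : ℂ) else -2 * (j : ℂ)⁻¹ * x j) =
      ∑ i, (2 * e i : ℂ) • logSeries (z i) := by
    ext n
    rw [PowerSeries.coeff_mk, map_sum]
    split_ifs with hn
    · subst hn
      simp [logSeries]
    · rw [hx n (Nat.pos_of_ne_zero hn), Finset.mul_sum]
      refine Finset.sum_congr rfl fun i _ => ?_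
      rw [PowerSeries.coeff_smul, logSeries, PowerSeries.coeff_mk]
      ring
  have h0 : ∀ i ∈ Finset.univ,
      constantCoeff (σ := Unit) ((2 * e i : ℂ) • logSeries (z i)) = 0 := by
    intro i _
    have := constantCoeff_logSeries (z i)
    change PowerSeries.constantCoeff _ = 0
    rw [PowerSeries.smul_eq_C_mul, map_mul, this, mul_zero]
  have hprod : HahnSeries.ofPowerSeries ℤ ℂ (fexp (σ := Unit)
      (PowerSeries.mk fun j : ℕ => if j = 0 then (0 : ℂ) else -2 * (j : ℂ)⁻¹ * x j)) =
      HahnSeries.single (2 * ∑ i, e i) 1 *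
        ∏ i, (zetaInf - HahnSeries.C (z i)) ^ (2 * e i) := by
    rw [hmk]
    refine (congrArg (HahnSeries.ofPowerSeries ℤ ℂ) (fexp_sum (σ := Unit) _ _ h0)).trans ?_
    refine (map_prod (HahnSeries.ofPowerSeries ℤ ℂ) _ _).trans ?_
    rw [Finset.prod_congr rfl fun i _ => ofPowerSeries_fexp_logSeries (he i) (z i)]
    simp only [mul_zpow]
    rw [Finset.prod_mul_distrib, Finset.mul_sum]
    congr 1
    induction (Finset.univ : Finset ι) using Finset.induction_on with
    | empty => rfl
    | insert i s hi ih =>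
      rw [Finset.prod_insert hi, Finset.sum_insert hi, ih, ← RatFunc.single_zpow (F := ℂ) (2 * e i),
        HahnSeries.single_mul_single, one_mul]
  have hcoeff := congrArg (fun f => f.coeff (m + 2 * ∑ i, e i)) hprod
  simp only [HahnSeries.coeff_single_mul, one_mul, add_sub_cancel_right] at hcoeff
  rw [← hcoeff, schur, PowerSeries.coeff_coe]
  by_cases h : 0 ≤ m + 2 * ∑ i, e i
  · rw [if_pos h, if_neg (not_lt.2 h)]
    congr 2
    omega
  · rw [if_neg h, if_pos (not_le.1 h)]

/-- Evaluation by residues of the coefficients that enter the root parts of the system. -/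
lemma schur_powerSum_eq_sum_residues (e : ι → ℤ) (he : ∀ i, e i = -1 ∨ e i = 0 ∨ e i = 1)
    (z : ι → ℂ) (hz : Function.Injective z) (x : ℕ → ℂ)
    (hx : ∀ n, 0 < n → x n = ∑ i, (e i : ℂ) * z i ^ n) (r : ℕ) :
    schur (fun n => -2 * (n : ℂ)⁻¹ * x n) ((r : ℤ) + 2 + 2 * ∑ i, e i) =
      ∑ j with e j = -1, (∏ i ∈ Finset.univ.erase j, (z j - z i) ^ (2 * e i)) *
        ((1 + z j * ∑ i ∈ Finset.univ.erase j, 2 * e i / (z j - z i)) * z j ^ r +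
          r * z j ^ r) := by
  rw [schur_powerSum e he z x hx]
  set s := Finset.univ.filter fun i => e i = -1 with hs
  set t := Finset.univ.filter fun i => e i = 1 with ht
  set f : Polynomial ℂ := Polynomial.X ^ (r + 1) *
    ∏ i ∈ t, (Polynomial.X - Polynomial.C (z i)) ^ 2 with hf
  -- Products over all indices split into the contributions of the zeros and of the poles.
  have hsplit : ∀ {K : Type} [Field K] (u : Finset ι) (c : ι → K), ∏ i ∈ u, c i ^ (2 * e i) =
      (∏ i ∈ u with e i = 1, c i ^ 2) * ∏ i ∈ u with e i = -1, (c i)⁻¹ ^ 2 := by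
    intro K _ u c
    rw [Finset.prod_filter, Finset.prod_filter, ← Finset.prod_mul_distrib]
    refine Finset.prod_congr rfl fun i _ => ?_
    rcases he i with h | h | h
    · rw [h, if_neg (by norm_num), if_pos rfl, one_mul, inv_pow]
      exact (zpow_neg (c i) 2).trans (congrArg _ (zpow_ofNat (c i) 2))
    · rw [h]
      simp
    · rw [h, if_pos rfl, if_neg (by norm_num)]
      simp only [mul_one]
      exact zpow_ofNat (c i) 2
  have hR : (∏ i, (zetaInf - HahnSeries.C (z i)) ^ (2 * e i)).coeff ((r : ℤ) + 2) =
      (polyInf f * ∏ i ∈ s, (zetaInf - HahnSeries.C (z i))⁻¹ ^ 2).coeff 1 := by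
    have hX : polyInf Polynomial.X = zetaInf := by simp [polyInf]
    have hXC : ∀ c, polyInf (Polynomial.X - Polynomial.C c) = zetaInf - HahnSeries.C c := by
      intro c
      simp [polyInf]
    rw [hsplit, hf, map_mul, map_prod, map_pow, hX]
    simp only [map_pow, hXC]
    rw [mul_assoc, zetaInf, HahnSeries.single_pow, HahnSeries.coeff_single_mul, one_pow, one_mul]
    congr 1
    simp
    ring
  rw [hR, coeff_polyInf_div s z hz f]
  refine Finset.sum_congr rfl fun j hj => ?_
  have hj1 : e j = -1 := by simpa [hs] using hj
  have hst : (Finset.univ.erase j).filter (fun i => e i = 1) = t := by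
    ext i
    simp only [ht, Finset.mem_filter, Finset.mem_erase, Finset.mem_univ, and_true, true_and,
      and_iff_right_iff_imp]
    rintro h rfl
    omega
  have hss : (Finset.univ.erase j).filter (fun i => e i = -1) = s.erase j := by
    rw [hs, Finset.filter_erase]
  have hne : ∀ i ∈ t, z j ≠ z i := by
    intro i hi
    refine hz.ne ?_
    rintro rfl
    rw [ht, Finset.mem_filter] at hi
    omega
  have hsum : ∑ i ∈ Finset.univ.erase j, 2 * (e i : ℂ) / (z j - z i) =
      ∑ i ∈ t, 2 / (z j - z i) - ∑ i ∈ s.erase j, 2 / (z j - z i) := by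
    rw [← hst, ← hss, Finset.sum_filter, Finset.sum_filter, ← Finset.sum_sub_distrib]
    refine Finset.sum_congr rfl fun i _ => ?_
    rcases he i with h | h | h
    · rw [h]
      norm_num
      ring
    · rw [h]
      simp
    · rw [h]
      norm_num
  rw [hsplit, hst, hss, hsum]
  have hf0 : f.eval (z j) = z j ^ (r + 1) * ∏ i ∈ t, (z j - z i) ^ 2 := by
    rw [hf, Polynomial.eval_mul, Polynomial.eval_prod]
    simp
  have hf1 : f.derivative.eval (z j) = ((r : ℂ) + 1) * z j ^ r * ∏ i ∈ t, (z j - z i) ^ 2 +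
      z j ^ (r + 1) * ((∏ i ∈ t, (z j - z i) ^ 2) * ∑ i ∈ t, 2 / (z j - z i)) := by
    rw [hf, Polynomial.derivative_mul, Polynomial.eval_add, Polynomial.eval_mul,
      Polynomial.eval_mul, eval_derivative_prod_sq t z _ hne, Polynomial.eval_prod]
    simp
  rw [hf0, hf1]
  simp only [inv_pow, Finset.prod_inv_distrib]
  ring

end PowerSums

/-! ### Residue form of the operators -/

lemma ySeries_congr {A : Type*} [CommRing A] {c c' : ℕ → A} (h : ∀ n, 0 < n → c n = c' n) :
    ySeries c = ySeries c' := by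
  rw [ySeries, ySeries]
  congr 1
  funext i
  cases i with
  | y n => exact h n n.pos
  | ut n => rfl
  | eps => rfl

lemma utSeries_congr {A : Type*} [CommRing A] {c c' : ℕ → A} (h : ∀ n, 0 < n → c n = c' n) :
    utSeries c = utSeries c' := by
  rw [utSeries, utSeries]
  congr 1
  funext i
  cases i with
  | ut n => exact h n n.pos
  | y n => rfl
  | eps => rfl

lemma ySeries_sum {ι A : Type*} [CommRing A] (s : Finset ι) (c : ι → ℕ → A) :
    ySeries (fun n => ∑ i ∈ s, c i n) = ∑ i ∈ s, ySeries (c i) := by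
  simp only [ySeries]
  rw [← linearSeries_sum]
  congr 1
  funext i
  rw [Finset.sum_apply]
  cases i <;> simp

lemma utSeries_sum {ι A : Type*} [CommRing A] (s : Finset ι) (c : ι → ℕ → A) :
    utSeries (fun n => ∑ i ∈ s, c i n) = ∑ i ∈ s, utSeries (c i) := by
  simp only [utSeries]
  rw [← linearSeries_sum]
  congr 1
  funext i
  rw [Finset.sum_apply]
  cases i <;> simp

lemma dilate_C (z a : ℂ) : dilate wt z (C a) = C a := by
  classical
  ext d
  rw [coeff_dilate, coeff_C]
  split_ifs with h
  · simp [h]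
  · simp

lemma dilate_eps_sub (z W : ℂ) : dilate wt z (X Par.eps - C W) = X Par.eps - C W := by
  classical
  rw [map_sub, dilate_C]
  congr 1
  ext d
  rw [coeff_dilate, coeff_X]
  split_ifs with h
  · rw [h, weight_single, wt, pow_zero, one_mul]
  · rw [mul_zero]

lemma euler_eps_sub (W : ℂ) : euler wt (X Par.eps - C W) = 0 := by
  classical
  ext d
  rw [coeff_euler, map_sub, coeff_X, coeff_C, map_zero]
  split_ifs with h h' h'
  · simp [h']
  · simp [h, weight_single, wt]
  · simp [h']
  · simp

lemma dilate_ySeries (z : ℂ) (c : ℕ → ℂ) :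
    dilate wt z (ySeries c) = ySeries fun n => z ^ n * c n := by
  rw [dilate_eq_weightScale, weightScale_ySeries]

lemma dilate_utSeries (z : ℂ) (c : ℕ → ℂ) :
    dilate wt z (utSeries c) = utSeries fun n => z ^ n * c n := by
  rw [dilate_eq_weightScale, weightScale_utSeries]

lemma euler_ySeries (c : ℕ → ℂ) : euler wt (ySeries c) = ySeries fun n => n * c n :=
  weightScale_ySeries (fun r => (r : ℂ)) c

lemma euler_utSeries (c : ℕ → ℂ) : euler wt (utSeries c) = utSeries fun n => n * c n :=
  weightScale_utSeries (fun r => (r : ℂ)) c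

lemma dilate_uExp (z W : ℂ) :
    dilate wt z (uExp W) = fexp ((X Par.eps - C W) * utSeries fun n => z ^ n) := by
  rw [uExp, dilate_fexp wt z (constantCoeff_mul_utSeries _ _), map_mul, dilate_eps_sub,
    dilate_utSeries]
  simp only [mul_one]

lemma dilate_yExp (z c : ℂ) : dilate wt z (yExp c) = fexp (ySeries fun n => c * z ^ n) := by
  rw [yExp, dilate_fexp wt z (constantCoeff_ySeries _), dilate_ySeries]
  simp only [mul_comm]

lemma euler_dilate_uExp (z W : ℂ) : euler wt (dilate wt z (uExp W)) =
    dilate wt z (uExp W) * ((X Par.eps - C W) * utSeries fun n => n * z ^ n) := by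
  rw [dilate_uExp, euler_fexp wt (constantCoeff_mul_utSeries _ _), Derivation.leibniz,
    euler_eps_sub, euler_utSeries, smul_zero, add_zero, smul_eq_mul]

lemma euler_dilate_yExp (z c : ℂ) : euler wt (dilate wt z (yExp c)) =
    dilate wt z (yExp c) * (C c * ySeries fun n => n * z ^ n) := by
  rw [dilate_yExp, euler_fexp wt (constantCoeff_ySeries _), euler_ySeries, C_mul_ySeries]
  congr 2
  funext n
  ring

/-- A combination of the weights `z^r` and `r z^r` acts by dilations and their Euler
derivatives. -/
lemma weightScale_sum_dilate {ι : Type*} (s : Finset ι) (z α β : ι → ℂ)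
    (F : MvPowerSeries Par ℂ) :
    weightScale wt (fun r => ∑ i ∈ s, (α i * z i ^ r + β i * (r * z i ^ r))) F =
      ∑ i ∈ s, (C (α i) * dilate wt (z i) F + C (β i) * euler wt (dilate wt (z i) F)) := by
  ext d
  rw [coeff_weightScale, map_sum, Finset.sum_mul]
  refine Finset.sum_congr rfl fun i _ => ?_
  rw [map_add, coeff_C_mul, coeff_C_mul, coeff_euler, coeff_dilate]
  ring

section Residues

lemma sum_antidiagonal_pow_mul_pow {x y : ℂ} (h : x ≠ y) (r : ℕ) :
    ∑ p ∈ Finset.HasAntidiagonal.antidiagonal r, x ^ p.1 * y ^ p.2 =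
      x ^ r * (x / (x - y)) + y ^ r * (y / (y - x)) := by
  have h1 := sub_ne_zero.2 h
  have h2 := sub_ne_zero.2 h.symm
  have := geom_sum₂_mul x y (r + 1)
  rw [Finset.Nat.sum_antidiagonal_eq_sum_range_succ (fun i j => x ^ i * y ^ j)]
  simp only [Nat.add_sub_cancel] at this
  have h3 : y - x = -(x - y) := by ring
  rw [h3, div_neg]
  field_simp
  rw [this]
  ring

variable {ι : Type*} [Fintype ι] (η κ : ι → ℤ) (z : ι → ℂ)

/-- The linear form of a family of solitons with charges `η` and `κ`. -/
def totalPhase : Var → ℂ := ∑ i, phase (η i) (κ i) (z i)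

lemma xVal_totalPhase {n : ℕ} (hn : 0 < n) :
    xVal (totalPhase η κ z) n = ∑ i, (η i : ℂ) * z i ^ n := by
  rw [xVal, dxPoly, dif_pos hn, MvPolynomial.aeval_X, totalPhase, Finset.sum_apply]
  rfl

lemma uVal_totalPhase {n : ℕ} (hn : 0 < n) :
    uVal (totalPhase η κ z) n = ∑ i, (κ i : ℂ) * z i ^ n := by
  rw [uVal, duPoly, dif_pos hn, MvPolynomial.aeval_X, totalPhase, Finset.sum_apply]
  rfl

lemma xVal_zero (v : Var → ℂ) : xVal v 0 = 0 := by simp [xVal, dxPoly]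

lemma totalPhase_w : totalPhase η κ z .w = ∑ i, (κ i : ℂ) := by
  rw [totalPhase, Finset.sum_apply]
  rfl

variable [DecidableEq ι]

/-- The contribution of a point `z_i` with `η_i = ±1` to the Cartan part: the residue at `z_i` of
the square of the field `∑ η_l ζ / (ζ - z_l) + ζ y'(ζ)`, together with the term linear in `ũ'`,
against `exp((ε - W) ũ(ζ)) dζ / ζ`, where `y(ζ) = ∑ y_n ζⁿ` and `ũ(ζ) = ∑ ũ_n ζⁿ`. -/
def residueTerm (i : ι) : MvPowerSeries Par ℂ :=
  (C (1 + z i * ∑ l ∈ Finset.univ.erase i, 2 * ((η i : ℂ) * η l) / (z i - z l)) +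
    (X Par.eps - C (∑ l, (κ l : ℂ)) + C (2 * (κ i : ℂ))) * (utSeries fun n => n * z i ^ n) +
    C (2 * (η i : ℂ)) * ySeries fun n => n * z i ^ n) * dilate wt (z i) (uExp (∑ l, (κ l : ℂ)))

/-- The coefficients of the square of a sum of simple poles. -/
lemma sum_antidiagonal_powerSum (hz : Function.Injective z) (r : ℕ) :
    ∑ p ∈ Finset.HasAntidiagonal.antidiagonal r,
        (∑ i, (η i : ℂ) * z i ^ p.1) * (∑ l, (η l : ℂ) * z l ^ p.2) =
      ∑ i, (((η i : ℂ) ^ 2 + z i * ∑ l ∈ Finset.univ.erase i,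
        2 * ((η i : ℂ) * η l) / (z i - z l)) * z i ^ r + (η i : ℂ) ^ 2 * (r * z i ^ r)) := by
  have h1 : ∑ p ∈ Finset.HasAntidiagonal.antidiagonal r,
        (∑ i, (η i : ℂ) * z i ^ p.1) * (∑ l, (η l : ℂ) * z l ^ p.2) =
      ∑ i, ∑ l, ((η i : ℂ) * η l) *
        ∑ p ∈ Finset.HasAntidiagonal.antidiagonal r, z i ^ p.1 * z l ^ p.2 := by
    rw [Finset.sum_congr rfl fun p _ => Finset.sum_mul_sum _ _ _ _, Finset.sum_comm]
    simp only [Finset.mul_sum]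
    refine Finset.sum_congr rfl fun i _ => ?_
    rw [Finset.sum_comm]
    refine Finset.sum_congr rfl fun l _ => Finset.sum_congr rfl fun p _ => ?_
    ring
  have h2 : ∀ i, ∑ l, ((η i : ℂ) * η l) *
        ∑ p ∈ Finset.HasAntidiagonal.antidiagonal r, z i ^ p.1 * z l ^ p.2 =
      (η i : ℂ) ^ 2 * ((r + 1) * z i ^ r) +
        ∑ l, ((if l = i then 0 else ((η i : ℂ) * η l) / (z i - z l) * z i ^ (r + 1)) +
          (if i = l then 0 else ((η l : ℂ) * η i) / (z l - z i) * z l ^ (r + 1))) := by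
    intro i
    rw [← Finset.add_sum_erase _ _ (Finset.mem_univ i), ← Finset.add_sum_erase Finset.univ
      (fun l => (if l = i then 0 else ((η i : ℂ) * η l) / (z i - z l) * z i ^ (r + 1)) +
          (if i = l then 0 else ((η l : ℂ) * η i) / (z l - z i) * z l ^ (r + 1)))
      (Finset.mem_univ i), if_pos rfl, add_zero, zero_add]
    congr 1
    · have : ∑ p ∈ Finset.HasAntidiagonal.antidiagonal r, z i ^ p.1 * z i ^ p.2 =
          (r + 1) * z i ^ r := by
        rw [Finset.sum_congr rfl (g := fun _ => z i ^ r)]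
        · rw [Finset.sum_const, Finset.Nat.card_antidiagonal, nsmul_eq_mul]
          push_cast
          ring
        · intro p hp
          rw [← pow_add, Finset.HasAntidiagonal.mem_antidiagonal.1 hp]
      rw [this]
      ring
    · refine Finset.sum_congr rfl fun l hl => ?_
      have hli := Finset.ne_of_mem_erase hl
      rw [if_neg hli, if_neg hli.symm, sum_antidiagonal_pow_mul_pow (hz.ne hli.symm)]
      ring
  rw [h1, Finset.sum_congr rfl fun i _ => h2 i, Finset.sum_add_distrib]
  simp only [Finset.sum_add_distrib]
  rw [Finset.sum_comm (f := fun i l => if i = l then (0 : ℂ) else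
    ((η l : ℂ) * η i) / (z l - z i) * z l ^ (r + 1)), ← Finset.sum_add_distrib,
    ← Finset.sum_add_distrib]
  rw [← Finset.sum_add_distrib]
  refine Finset.sum_congr rfl fun i _ => ?_
  have h3 : ∑ l, (if l = i then 0 else ((η i : ℂ) * η l) / (z i - z l) * z i ^ (r + 1)) =
      ∑ l ∈ Finset.univ.erase i, ((η i : ℂ) * η l) / (z i - z l) * z i ^ (r + 1) := by
    rw [← Finset.add_sum_erase _ _ (Finset.mem_univ i), if_pos rfl, zero_add]
    exact Finset.sum_congr rfl fun l hl => if_neg (Finset.ne_of_mem_erase hl)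
  rw [h3, ← Finset.sum_mul]
  have h4 : ∑ l ∈ Finset.univ.erase i, 2 * ((η i : ℂ) * η l) / (z i - z l) =
      2 * ∑ l ∈ Finset.univ.erase i, ((η i : ℂ) * η l) / (z i - z l) := by
    rw [Finset.mul_sum]
    exact Finset.sum_congr rfl fun l _ => mul_div_assoc _ _ _
  rw [h4]
  ring

lemma component_zero_uExp (W : ℂ) : weightedHomogeneousComponent wt 0 (uExp W) = 1 := by
  rw [uExp, ← schur_eq_component wt (c := fun n => weightedHomogeneousComponent wt n
    ((X Par.eps - C W) * utSeries fun _ => 1)) (fun j _ => rfl)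
    (by rw [component_eps_sub_mul_utSeries, utSeries, component_zero_linearSeries rfl, mul_zero]),
    schur, if_pos (by norm_num)]
  change PowerSeries.coeff 0 (fexp (σ := Unit) _) = 1
  rw [PowerSeries.coeff_zero_eq_constantCoeff_apply]
  refine constantCoeff_fexp (σ := Unit) ?_
  change PowerSeries.constantCoeff _ = 0
  rw [← PowerSeries.coeff_zero_eq_constantCoeff_apply, PowerSeries.coeff_mk, if_pos rfl]

lemma C_eq_weightScale_uExp (a W : ℂ) :
    C a = weightScale wt (fun r => if r = 0 then a else 0) (uExp W) := by
  ext d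
  have := congrArg (fun F => coeff d (C a * F)) (component_zero_uExp W)
  simp only [coeff_C_mul, coeff_component] at this
  rw [coeff_weightScale, ← mul_one (C a), coeff_C_mul, ← this]
  split_ifs <;> simp

/-- The hypothesis on `κ` discards the term linear in `ũ'` at the points with `η_i = 0`, which the
right side does not contain. -/
lemma evalSym_cartanPart_eq_sum_residues (hη : ∀ i, η i = -1 ∨ η i = 0 ∨ η i = 1)
    (hκ : ∀ i, η i = 0 → κ i = 0) (hz : Function.Injective z) :
    evalSym (totalPhase η κ z) (cartanPart (∑ i, η i)) =
      ∑ i, C ((η i : ℂ) ^ 2) * residueTerm η κ z i := by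
  rw [evalSym_cartanPart, totalPhase_w]
  set W := ∑ i, (κ i : ℂ) with hW
  have hy : ∀ r, 2 * (ySeries fun k => (k : ℂ) * xVal (totalPhase η κ z) (r + k)) =
      ∑ i, (C (2 * (η i : ℂ)) * ySeries fun n => n * z i ^ n) * C (z i ^ r) := by
    intro r
    have : (ySeries fun k => (k : ℂ) * xVal (totalPhase η κ z) (r + k)) =
        ySeries fun k => ∑ i, ((η i : ℂ) * z i ^ r) * (k * z i ^ k) := by
      refine ySeries_congr fun n hn => ?_
      rw [xVal_totalPhase η κ z (Nat.add_pos_right r hn), Finset.mul_sum]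
      refine Finset.sum_congr rfl fun i _ => ?_
      ring
    rw [this, ySeries_sum, Finset.mul_sum]
    refine Finset.sum_congr rfl fun i _ => ?_
    rw [← C_mul_ySeries, map_mul, map_mul, map_ofNat]
    ring
  have hu : ∀ r, 2 * (utSeries fun k => (k : ℂ) * uVal (totalPhase η κ z) (r + k)) =
      ∑ i, (C (2 * (κ i : ℂ)) * utSeries fun n => n * z i ^ n) * C (z i ^ r) := by
    intro r
    have : (utSeries fun k => (k : ℂ) * uVal (totalPhase η κ z) (r + k)) =
        utSeries fun k => ∑ i, ((κ i : ℂ) * z i ^ r) * (k * z i ^ k) := by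
      refine utSeries_congr fun n hn => ?_
      rw [uVal_totalPhase η κ z (Nat.add_pos_right r hn), Finset.mul_sum]
      refine Finset.sum_congr rfl fun i _ => ?_
      ring
    rw [this, utSeries_sum, Finset.mul_sum]
    refine Finset.sum_congr rfl fun i _ => ?_
    rw [← C_mul_utSeries, map_mul, map_mul, map_ofNat]
    ring
  simp only [hy, hu]
  rw [componentSum_add, componentSum_add, componentSum_C, componentSum_sum, componentSum_sum]
  simp only [componentSum_mul_left, componentSum_C, ← dilate_eq_weightScale]
  rw [C_eq_weightScale_uExp _ W, ← add_assoc, ← add_assoc]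
  -- The terms `p²` and `2p D_{x_r}` supply the power sums of index `0`, which are `∑ η_i = p`
  -- whereas `D_{x_0} = 0`.
  have hscal : weightScale wt (fun r => if r = 0 then (((∑ i, η i : ℤ) : ℂ)) ^ 2 else 0) (uExp W) +
      weightScale wt (fun r => 2 * ((∑ i, η i : ℤ) : ℂ) * xVal (totalPhase η κ z) r +
        ∑ jk ∈ Finset.HasAntidiagonal.antidiagonal r,
          xVal (totalPhase η κ z) jk.1 * xVal (totalPhase η κ z) jk.2) (uExp W) =
      weightScale wt (fun r => ∑ p ∈ Finset.HasAntidiagonal.antidiagonal r,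
        (∑ i, (η i : ℂ) * z i ^ p.1) * (∑ l, (η l : ℂ) * z l ^ p.2)) (uExp W) := by
    ext d
    rw [map_add, coeff_weightScale, coeff_weightScale, coeff_weightScale, ← add_mul]
    congr 1
    generalize Finsupp.weight wt d = r
    have hmk : (PowerSeries.mk fun n => ∑ i, (η i : ℂ) * z i ^ n) =
        PowerSeries.C ((∑ i, η i : ℤ) : ℂ) + PowerSeries.mk (xVal (totalPhase η κ z)) := by
      ext n
      rw [map_add, PowerSeries.coeff_mk, PowerSeries.coeff_mk, PowerSeries.coeff_C]
      split_ifs with hn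
      · simp [hn, xVal_zero]
      · rw [xVal_totalPhase η κ z (Nat.pos_of_ne_zero hn), zero_add]
    have h1 := congrArg (fun F => PowerSeries.coeff r (F * F)) hmk
    simp only [PowerSeries.coeff_mul, PowerSeries.coeff_mk] at h1
    rw [h1, ← PowerSeries.coeff_mul, add_mul, mul_add, mul_add, ← map_mul,
      mul_comm (PowerSeries.mk _) (PowerSeries.C _)]
    simp only [map_add, PowerSeries.coeff_C_mul]
    simp only [PowerSeries.coeff_mul, PowerSeries.coeff_mk, PowerSeries.coeff_C]
    split_ifs <;> ring
  rw [hscal]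
  simp only [sum_antidiagonal_powerSum η z hz]
  rw [weightScale_sum_dilate, ← Finset.sum_add_distrib, ← Finset.sum_add_distrib]
  refine Finset.sum_congr rfl fun i _ => ?_
  rw [residueTerm, ← hW, euler_dilate_uExp]
  rcases hη i with h | h | h
  · rw [h]
    simp
    ring
  · rw [h, hκ i h]
    simp
  · rw [h]
    simp
    ring

end Residues

/-! ### Exchanging a soliton between the two factors -/

section Flip

variable {ι : Type*} [Fintype ι] [DecidableEq ι] {η κ η' κ' : ι → ℤ} {z : ι → ℂ}

/-- The degrees of the components in the root part differ by `p - 2σ`, whence the shift by `2σ`. -/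
lemma evalSym_rootPart_eq_sum_residues (hη : ∀ i, η i = -1 ∨ η i = 0 ∨ η i = 1)
    (hz : Function.Injective z) {σ : ℤ} (hσ : σ = 1 ∨ σ = -1) :
    evalSym (totalPhase η κ z) (rootPart σ (∑ i, η i + 2 * σ)) =
      ∑ j with σ * η j = -1, C (∏ i ∈ Finset.univ.erase j, (z j - z i) ^ (2 * (σ * η i))) *
        (C (1 + z j * ∑ i ∈ Finset.univ.erase j, 2 * ((σ * η i : ℤ) : ℂ) / (z j - z i)) *
            dilate wt (z j) (uExp (∑ i, (κ i : ℂ)) * yExp (2 * σ)) +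
          euler wt (dilate wt (z j) (uExp (∑ i, (κ i : ℂ)) * yExp (2 * σ)))) := by
  have he : ∀ i, σ * η i = -1 ∨ σ * η i = 0 ∨ σ * η i = 1 := by
    intro i
    rcases hσ with rfl | rfl <;> rcases hη i with h | h | h <;> rw [h] <;> norm_num
  have hx : ∀ n, 0 < n → (σ : ℂ) * xVal (totalPhase η κ z) n =
      ∑ i, ((σ * η i : ℤ) : ℂ) * z i ^ n := by
    intro n hn
    rw [xVal_totalPhase η κ z hn, Finset.mul_sum]
    refine Finset.sum_congr rfl fun i _ => ?_
    push_cast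
    ring
  have hs : (fun r : ℕ => schur (fun n : ℕ => (-2 * (σ : ℂ)) * (n : ℂ)⁻¹ *
      xVal (totalPhase η κ z) n) ((r : ℤ) - 2 + 2 * σ * (∑ i, η i + 2 * σ))) =
      fun r : ℕ => ∑ j with σ * η j = -1,
        ((∏ i ∈ Finset.univ.erase j, (z j - z i) ^ (2 * (σ * η i))) *
          (1 + z j * ∑ i ∈ Finset.univ.erase j, 2 * ((σ * η i : ℤ) : ℂ) / (z j - z i)) *
            z j ^ r +
          (∏ i ∈ Finset.univ.erase j, (z j - z i) ^ (2 * (σ * η i))) * (r * z j ^ r)) := by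
    funext r
    have h1 : (r : ℤ) - 2 + 2 * σ * (∑ i, η i + 2 * σ) = r + 2 + 2 * ∑ i, σ * η i := by
      rw [← Finset.mul_sum]
      rcases hσ with rfl | rfl <;> ring
    have h2 : (fun n : ℕ => (-2 * (σ : ℂ)) * (n : ℂ)⁻¹ * xVal (totalPhase η κ z) n) =
        fun n : ℕ => -2 * (n : ℂ)⁻¹ * ((σ : ℂ) * xVal (totalPhase η κ z) n) := by
      funext n
      ring
    rw [h1, h2, schur_powerSum_eq_sum_residues _ he z hz _ hx]
    refine Finset.sum_congr rfl fun j _ => ?_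
    ring
  rw [evalSym_rootPart, totalPhase_w, hs, weightScale_sum_dilate]
  refine Finset.sum_congr rfl fun j _ => ?_
  rw [map_mul C]
  ring

/-- Moving the soliton `j` from one factor of the Hirota product to the other turns the residue
at `z_j` of the root part into that of the Cartan part. -/
lemma residueTerm_mul_evalSym_expD {σ : ℤ} (j : ι) (hj : η j = -σ)
    (hη' : ∀ i, η' i = if i = j then -η i else η i)
    (hκ' : ∀ i, κ' i = if i = j then -κ i else κ i) :
    (C (1 + z j * ∑ i ∈ Finset.univ.erase j, 2 * ((σ * η i : ℤ) : ℂ) / (z j - z i)) *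
            dilate wt (z j) (uExp (∑ i, (κ i : ℂ)) * yExp (2 * σ)) +
          euler wt (dilate wt (z j) (uExp (∑ i, (κ i : ℂ)) * yExp (2 * σ)))) *
        evalSym (totalPhase η κ z) expD =
      residueTerm η' κ' z j * evalSym (totalPhase η' κ' z) expD := by
  have hflip : ∀ (θ θ' : ι → ℤ) (_ : ∀ i, θ' i = if i = j then -θ i else θ i) (c : ι → ℂ),
      ∑ i, (θ i : ℂ) * c i = ∑ i, (θ' i : ℂ) * c i + 2 * θ j * c j := by
    intro θ θ' h c
    rw [← Finset.add_sum_erase _ _ (Finset.mem_univ j),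
      ← Finset.add_sum_erase Finset.univ (fun i => (θ' i : ℂ) * c i) (Finset.mem_univ j), h j,
      if_pos rfl, Finset.sum_congr rfl fun i hi => by
        rw [← if_neg (Finset.ne_of_mem_erase hi) (t := -θ i) (e := θ i), ← h i]]
    push_cast
    ring
  have hW : ∑ i, (κ i : ℂ) = ∑ i, (κ' i : ℂ) + 2 * κ j := by
    simpa using hflip κ κ' hκ' 1
  have hcoef : ∑ l ∈ Finset.univ.erase j, 2 * ((η' j : ℂ) * η' l) / (z j - z l) =
      ∑ i ∈ Finset.univ.erase j, 2 * ((σ * η i : ℤ) : ℂ) / (z j - z i) := by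
    refine Finset.sum_congr rfl fun i hi => ?_
    rw [hη' j, hη' i, if_pos rfl, if_neg (Finset.ne_of_mem_erase hi), hj, neg_neg]
    push_cast
    rfl
  have hexp : dilate wt (z j) (uExp (∑ i, (κ i : ℂ))) * dilate wt (z j) (yExp (2 * σ)) *
      evalSym (totalPhase η κ z) expD = dilate wt (z j) (uExp (∑ i, (κ' i : ℂ))) *
        evalSym (totalPhase η' κ' z) expD := by
    have hy : (ySeries fun n => 2 * (σ : ℂ) * z j ^ n) + ySeries (xVal (totalPhase η κ z)) =
        ySeries (xVal (totalPhase η' κ' z)) := by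
      rw [← ySeries_add]
      refine ySeries_congr fun n hn => ?_
      rw [Pi.add_apply, xVal_totalPhase _ _ _ hn, xVal_totalPhase _ _ _ hn,
        hflip η η' hη' fun i => z i ^ n, hj]
      push_cast
      ring
    have hu : (X Par.eps - C (∑ i, (κ i : ℂ))) * (utSeries fun n => z j ^ n) +
        utSeries (uVal (totalPhase η κ z)) =
        (X Par.eps - C (∑ i, (κ' i : ℂ))) * (utSeries fun n => z j ^ n) +
        utSeries (uVal (totalPhase η' κ' z)) := by
      have : utSeries (uVal (totalPhase η κ z)) = utSeries (uVal (totalPhase η' κ' z)) +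
          C (2 * (κ j : ℂ)) * utSeries fun n => z j ^ n := by
        rw [C_mul_utSeries, ← utSeries_add]
        refine utSeries_congr fun n hn => ?_
        rw [Pi.add_apply, uVal_totalPhase _ _ _ hn, uVal_totalPhase _ _ _ hn,
          hflip κ κ' hκ' fun i => z i ^ n]
      rw [this, hW, map_add]
      ring
    rw [dilate_uExp, dilate_uExp, dilate_yExp, evalSym_expD, evalSym_expD, ← hy,
      fexp_add (constantCoeff_ySeries _) (constantCoeff_ySeries _)]
    have := congrArg fexp hu
    rw [fexp_add (constantCoeff_mul_utSeries _ _) (constantCoeff_utSeries _),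
      fexp_add (constantCoeff_mul_utSeries _ _) (constantCoeff_utSeries _)] at this
    linear_combination fexp (ySeries fun n => 2 * (σ : ℂ) * z j ^ n) *
      fexp (ySeries (xVal (totalPhase η κ z))) * this
  rw [map_mul, Derivation.leibniz, euler_dilate_uExp, euler_dilate_yExp, residueTerm, hcoef,
    mul_assoc (_ + _ + _) (dilate _ _ _), ← hexp, hη' j, hκ' j, if_pos rfl, if_pos rfl, hj, hW]
  simp only [map_add, map_mul, smul_eq_mul, Int.cast_neg, neg_neg, map_neg]
  ring

end Flip

/-! ### Hirota products of soliton sums -/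

lemma exists_linearMap_hirotaPoly (P : MvPolynomial Var ℂ) :
    ∃ Φ : TensorProduct ℂ Ser Ser →ₗ[ℂ] Ser, ∀ f g, hirotaPoly P f g = Φ (f ⊗ₜ[ℂ] g) := by
  have h : ∀ m : Multiset Var, ∃ Φ : TensorProduct ℂ Ser Ser →ₗ[ℂ] TensorProduct ℂ Ser Ser,
      ∀ t, m.foldr (fun v t => hirotaD v t) t = Φ t := by
    intro m
    induction m using Multiset.induction_on with
    | empty => exact ⟨LinearMap.id, fun t => by simp⟩
    | cons v m ih =>
      obtain ⟨Φ, hΦ⟩ := ih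
      exact ⟨hirotaD v ∘ₗ Φ, fun t => by rw [Multiset.foldr_cons, hΦ]; rfl⟩
  choose Φ hΦ using h
  refine ⟨LinearMap.mul' ℂ Ser ∘ₗ ∑ d ∈ P.support, P.coeff d • Φ (Finsupp.toMultiset d),
    fun f g => ?_⟩
  rw [hirotaPoly]
  simp [hΦ]

lemma coeff_hirota_sum_expLin {ι κ : Type*} [Fintype ι] [Fintype κ] (P : Sym) (a : ι → ℂ)
    (b : κ → ℂ) (L : ι → Var → ℂ) (M : κ → Var → ℂ) (d : Par →₀ ℕ) :
    coeff d (hirota P (∑ i, a i • expLin (L i)) (∑ j, b j • expLin (M j))) =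
      ∑ q : ι × κ, (a q.1 * b q.2 * coeff d (evalSym (L q.1 - M q.2) P)) •
        expLin (L q.1 + M q.2) := by
  obtain ⟨Φ, hΦ⟩ := exists_linearMap_hirotaPoly (coeff d P)
  have h : ∀ f g, coeff d (hirota P f g) = Φ (f ⊗ₜ[ℂ] g) := hΦ
  rw [h, TensorProduct.sum_tmul, map_sum, Fintype.sum_prod_type]
  refine Finset.sum_congr rfl fun i _ => ?_
  rw [TensorProduct.tmul_sum, map_sum]
  refine Finset.sum_congr rfl fun j _ => ?_
  rw [TensorProduct.smul_tmul_smul, map_smul, ← h, coeff_hirota_expLin, smul_smul]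

section Pairs

variable {ι : Type*} [LinearOrder ι]

/-- The indicator function of `J` minus that of `K`, weighted by `c`. -/
def pairDiff (c : ι → ℤ) (q : Finset ι × Finset ι) (i : ι) : ℤ :=
  (if i ∈ q.1 then c i else 0) - (if i ∈ q.2 then c i else 0)

/-- Toggles the membership of `j` in both factors; if exactly one factor contains `j`, this moves
`j` to the other one. -/
def flipPair (j : ι) : Equiv.Perm (Finset ι × Finset ι) :=
  Function.Involutive.toPerm (fun q => (symmDiff q.1 {j}, symmDiff q.2 {j})) fun q => by
    simp [symmDiff_symmDiff_cancel_right]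

lemma flipPair_apply (j : ι) (q : Finset ι × Finset ι) :
    flipPair j q = (symmDiff q.1 {j}, symmDiff q.2 {j}) := rfl

lemma pairDiff_flipPair (c : ι → ℤ) (j : ι) (q : Finset ι × Finset ι) (i : ι) :
    pairDiff c (flipPair j q) i = if i = j then -pairDiff c q i else pairDiff c q i := by
  simp only [pairDiff, flipPair_apply, Finset.mem_symmDiff, Finset.mem_singleton]
  by_cases h : i = j
  · subst h
    by_cases h1 : i ∈ q.1 <;> by_cases h2 : i ∈ q.2 <;> simp [h1, h2]
  · simp [h]

lemma sum_pairDiff [Fintype ι] (ε : ι → ℤˣ) (q : Finset ι × Finset ι) :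
    ∑ i, pairDiff (fun i => (ε i : ℤ)) q i = charge ε q.1 - charge ε q.2 := by
  simp only [pairDiff, Finset.sum_sub_distrib, charge, Finset.sum_ite_mem, Finset.univ_inter]

lemma pairDiff_eq (ε : ι → ℤˣ) (q : Finset ι × Finset ι) (i : ι) :
    pairDiff (fun i => (ε i : ℤ)) q i = -1 ∨ pairDiff (fun i => (ε i : ℤ)) q i = 0 ∨
      pairDiff (fun i => (ε i : ℤ)) q i = 1 := by
  rw [pairDiff]
  rcases Int.units_eq_one_or (ε i) with h | h <;> rw [h] <;> split_ifs <;> simp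

lemma pairDiff_eq_zero (ε : ι → ℤˣ) (c : ι → ℤ) {q : Finset ι × Finset ι} {i : ι}
    (h : pairDiff (fun i => (ε i : ℤ)) q i = 0) : pairDiff c q i = 0 := by
  rw [pairDiff] at h ⊢
  split_ifs at h ⊢ <;> simp_all

lemma phase_sub (σ σ' k k' : ℤ) (z : ℂ) :
    phase (σ - σ') (k - k') z = phase σ k z - phase σ' k' z := by
  funext v
  cases v <;> simp [phase, sub_mul]

lemma phase_zero (z : ℂ) : phase 0 0 z = 0 := by
  funext v
  cases v <;> simp [phase]

lemma sum_phase_sub_sum_phase [Fintype ι] (c k : ι → ℤ) (z : ι → ℂ) (q : Finset ι × Finset ι) :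
    ∑ j ∈ q.1, phase (c j) (k j) (z j) - ∑ j ∈ q.2, phase (c j) (k j) (z j) =
      totalPhase (pairDiff c q) (pairDiff k q) z := by
  rw [totalPhase]
  simp only [pairDiff, phase_sub, Finset.sum_sub_distrib]
  have : ∀ J : Finset ι, ∑ j ∈ J, phase (c j) (k j) (z j) =
      ∑ j, phase (if j ∈ J then c j else 0) (if j ∈ J then k j else 0) (z j) := by
    intro J
    rw [← Finset.univ_inter J, ← Finset.sum_ite_mem]
    refine Finset.sum_congr rfl fun j _ => ?_
    simp only [Finset.univ_inter]
    split_ifs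
    · rfl
    · rw [phase_zero]
  rw [← this, ← this]

lemma symmDiff_singleton_of_mem {J : Finset ι} {j : ι} (hJ : j ∈ J) :
    symmDiff J {j} = J.erase j := by
  ext i
  by_cases hij : i = j <;> simp [Finset.mem_symmDiff, hij, hJ]

lemma symmDiff_singleton_of_notMem {J : Finset ι} {j : ι} (hJ : j ∉ J) :
    symmDiff J {j} = insert j J := by
  ext i
  by_cases hij : i = j <;> simp [Finset.mem_symmDiff, hij, hJ]

/-- The products of coefficients of two pairs exchanged by `flipPair j`, when the first factor
contains `j`. -/
lemma solitonCoeff_insert_mul_add [Fintype ι] (ε : ι → ℤˣ) (a : ι → ℂ) {z : ι → ℂ}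
    (hz : Function.Injective z) {J K : Finset ι} {j : ι} (hJ : j ∉ J) (hK : j ∉ K) :
    solitonCoeff ε a z (insert j J) * solitonCoeff ε a z K +
      (-1) ^ (charge ε (insert j J) - charge ε K) *
        (solitonCoeff ε a z J * solitonCoeff ε a z (insert j K) *
          ∏ i ∈ Finset.univ.erase j,
            (z j - z i) ^ (2 * ((ε j : ℤ) * pairDiff (fun i => (ε i : ℤ)) (J, K) i))) = 0 := by
  have hsub : ∀ i ∈ Finset.univ.erase j, z j - z i ≠ 0 := fun i hi =>
    sub_ne_zero.2 (hz.ne (Finset.ne_of_mem_erase hi).symm)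
  have hext : ∀ L : Finset ι, j ∉ L → ∏ i ∈ L, (z j - z i) ^ (2 * ((ε j : ℤ) * ε i)) =
      ∏ i ∈ Finset.univ.erase j,
        (z j - z i) ^ (2 * ((ε j : ℤ) * if i ∈ L then (ε i : ℤ) else 0)) := by
    intro L hL
    have hsubset : L ⊆ Finset.univ.erase j := fun i hi => Finset.mem_erase.2
      ⟨fun h => hL (h ▸ hi), Finset.mem_univ i⟩
    rw [← Finset.prod_subset hsubset fun i _ hi => by rw [if_neg hi]; simp]
    exact Finset.prod_congr rfl fun i hi => by rw [if_pos hi]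
  have hprod : (∏ i ∈ K, (z j - z i) ^ (2 * ((ε j : ℤ) * ε i))) *
      ∏ i ∈ Finset.univ.erase j,
        (z j - z i) ^ (2 * ((ε j : ℤ) * pairDiff (fun i => (ε i : ℤ)) (J, K) i)) =
      ∏ i ∈ J, (z j - z i) ^ (2 * ((ε j : ℤ) * ε i)) := by
    rw [hext J hJ, hext K hK, ← Finset.prod_mul_distrib]
    refine Finset.prod_congr rfl fun i hi => ?_
    rw [← zpow_add₀ (hsub i hi)]
    congr 1
    rw [pairDiff]
    ring
  have hsign : (-1 : ℂ) ^ (charge ε (insert j J) - charge ε K) =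
      -((-1) ^ J.card * (-1) ^ K.card) := by
    rw [zpow_sub₀ (by norm_num), neg_one_zpow_charge, neg_one_zpow_charge,
      Finset.card_insert_of_notMem hJ, pow_succ, div_eq_mul_inv, ← inv_pow]
    norm_num
  have hsq : ((-1 : ℂ) ^ K.card) * (-1) ^ K.card = 1 := by rw [← mul_pow]; simp
  rw [solitonCoeff_insert ε a z hJ, solitonCoeff_insert ε a z hK, hsign, ← hprod]
  linear_combination (-(-1) ^ J.card * a j * solitonCoeff ε a z J * solitonCoeff ε a z K *
    (∏ i ∈ K, (z j - z i) ^ (2 * ((ε j : ℤ) * ε i))) * ∏ i ∈ Finset.univ.erase j,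
        (z j - z i) ^ (2 * ((ε j : ℤ) * pairDiff (fun i => (ε i : ℤ)) (J, K) i))) * hsq

/-- If exactly one factor of `q` contains `j`, it contains it in the first or in the second one,
and the other factor is enlarged by `flipPair j`. -/
lemma exists_of_pairDiff_ne_zero {c : ι → ℤ} {q : Finset ι × Finset ι} {j : ι}
    (h : pairDiff c q j ≠ 0) : ∃ J K : Finset ι, j ∉ J ∧ j ∉ K ∧
      ((q = (insert j J, K) ∧ flipPair j q = (J, insert j K) ∧ pairDiff c q j = c j) ∨
        (q = (K, insert j J) ∧ flipPair j q = (insert j K, J) ∧ pairDiff c q j = -c j)) := by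
  obtain ⟨J, K⟩ := q
  by_cases h1 : j ∈ J <;> by_cases h2 : j ∈ K
  · exact absurd (by simp [pairDiff, h1, h2]) h
  · refine ⟨J.erase j, K, Finset.notMem_erase j J, h2, Or.inl ⟨?_, ?_, ?_⟩⟩
    · rw [Finset.insert_erase h1]
    · rw [flipPair_apply, symmDiff_singleton_of_mem h1, symmDiff_singleton_of_notMem h2]
    · simp [pairDiff, h1, h2]
  · refine ⟨K.erase j, J, Finset.notMem_erase j K, h1, Or.inr ⟨?_, ?_, ?_⟩⟩
    · rw [Finset.insert_erase h2]
    · rw [flipPair_apply, symmDiff_singleton_of_mem h2, symmDiff_singleton_of_notMem h1]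
    · simp [pairDiff, h1, h2]
  · exact absurd (by simp [pairDiff, h1, h2]) h

lemma sum_add_sum_flipPair {M : Type*} [AddCommMonoid M] (f : ι → M) {c : ι → ℤ}
    {q : Finset ι × Finset ι} {j : ι} (h : pairDiff c q j ≠ 0) :
    ∑ i ∈ (flipPair j q).1, f i + ∑ i ∈ (flipPair j q).2, f i =
      ∑ i ∈ q.1, f i + ∑ i ∈ q.2, f i := by
  obtain ⟨J, K, hJ, hK, ⟨hq, hq', -⟩ | ⟨hq, hq', -⟩⟩ := exists_of_pairDiff_ne_zero h
  all_goals
    rw [hq', hq]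
    dsimp only
    rw [Finset.sum_insert hJ, Finset.sum_insert hK]
    abel

lemma charge_flipPair (ε : ι → ℤˣ) {q : Finset ι × Finset ι} {j : ι}
    (h : pairDiff (fun i => (ε i : ℤ)) q j ≠ 0) :
    charge ε (flipPair j q).1 = charge ε q.1 - pairDiff (fun i => (ε i : ℤ)) q j ∧
      charge ε (flipPair j q).2 = charge ε q.2 + pairDiff (fun i => (ε i : ℤ)) q j := by
  obtain ⟨J, K, hJ, hK, ⟨hq, hq', hd⟩ | ⟨hq, hq', hd⟩⟩ := exists_of_pairDiff_ne_zero h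
  all_goals
    rw [hq', hd, hq]
    dsimp only [charge]
    rw [Finset.sum_insert hJ, Finset.sum_insert hK]
    constructor <;> ring

/-- The cancellation between the Cartan part and the root parts. -/
lemma solitonCoeff_mul_add_flipPair [Fintype ι] (ε : ι → ℤˣ) (a : ι → ℂ) {z : ι → ℂ}
    (hz : Function.Injective z) {q : Finset ι × Finset ι} {j : ι}
    (h : pairDiff (fun i => (ε i : ℤ)) q j ≠ 0) :
    solitonCoeff ε a z q.1 * solitonCoeff ε a z q.2 +
      (-1) ^ (charge ε q.1 - charge ε q.2) *
        (solitonCoeff ε a z (flipPair j q).1 * solitonCoeff ε a z (flipPair j q).2 *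
          ∏ i ∈ Finset.univ.erase j, (z j - z i) ^ (2 * (pairDiff (fun i => (ε i : ℤ)) q j *
            pairDiff (fun i => (ε i : ℤ)) (flipPair j q) i))) = 0 := by
  have hprod : ∀ (J K : Finset ι) (c : ι → ℤ) (i : ι), i ∈ Finset.univ.erase j →
      pairDiff c (J, insert j K) i = pairDiff c (J, K) i ∧
      pairDiff c (insert j K, J) i = -pairDiff c (J, K) i := by
    intro J K c i hi
    simp [pairDiff, Finset.ne_of_mem_erase hi]
  obtain ⟨J, K, hJ, hK, ⟨hq, hq', hd⟩ | ⟨hq, hq', hd⟩⟩ := exists_of_pairDiff_ne_zero h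
  · rw [hq', hd, hq, ← solitonCoeff_insert_mul_add ε a hz hJ hK]
    congr 3
    refine Finset.prod_congr rfl fun i hi => ?_
    rw [(hprod J K _ i hi).1]
  · rw [hq', hd, hq, ← solitonCoeff_insert_mul_add ε a hz hJ hK,
      mul_comm (solitonCoeff ε a z K) (solitonCoeff ε a z (insert j J)),
      mul_comm (solitonCoeff ε a z (insert j K)) (solitonCoeff ε a z J),
      ← neg_sub (charge ε (insert j J)), zpow_neg, ← inv_zpow, inv_neg_one]
    congr 3
    refine Finset.prod_congr rfl fun i hi => ?_
    rw [(hprod J K _ i hi).2, neg_mul_neg]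

end Pairs

/-! ### The bilinear system for soliton sums -/

section System

variable {ι : Type*} [LinearOrder ι]

/-- The difference of the linear forms of the two exponentials labelled by `q`. -/
def pairPhase [Fintype ι] (ε : ι → ℤˣ) (k : ι → ℤ) (z : ι → ℂ) (q : Finset ι × Finset ι) :
    Var → ℂ :=
  totalPhase (pairDiff (fun i => (ε i : ℤ)) q) (pairDiff k q) z

/-- The product of the coefficients of the two exponentials labelled by `q` in the components of
degrees `m` and `n`. -/
def pairCoeff (ε : ι → ℤˣ) (a z : ι → ℂ) (m n : ℤ) (q : Finset ι × Finset ι) : ℂ :=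
  (if m = charge ε q.1 then solitonCoeff ε a z q.1 else 0) *
    (if n = charge ε q.2 then solitonCoeff ε a z q.2 else 0)

/-- The product of the two exponentials labelled by `q`. -/
def pairExp (ε : ι → ℤˣ) (k : ι → ℤ) (z : ι → ℂ) (q : Finset ι × Finset ι) : Ser :=
  expLin (∑ j ∈ q.1, phase (ε j) (k j) (z j) + ∑ j ∈ q.2, phase (ε j) (k j) (z j))

lemma coeff_hirota_solitonSum [Fintype ι] (ε : ι → ℤˣ) (a : ι → ℂ) (k : ι → ℤ) (z : ι → ℂ) (P : Sym)
    (m n : ℤ) (d : Par →₀ ℕ) :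
    coeff d (hirota P (solitonSum ε a k z m) (solitonSum ε a k z n)) =
      ∑ q : Finset ι × Finset ι,
        (pairCoeff ε a z m n q * coeff d (evalSym (pairPhase ε k z q) P)) •
          pairExp ε k z q := by
  rw [solitonSum_apply, solitonSum_apply, coeff_hirota_sum_expLin]
  refine Finset.sum_congr rfl fun q _ => ?_
  rw [sum_phase_sub_sum_phase (fun i => (ε i : ℤ))]
  rfl

lemma eq_charge_of_pairCoeff_ne_zero {ε : ι → ℤˣ} {a z : ι → ℂ} {m n : ℤ} {q : Finset ι × Finset ι}
    (h : pairCoeff ε a z m n q ≠ 0) : m = charge ε q.1 ∧ n = charge ε q.2 := by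
  by_contra h'
  rw [not_and_or] at h'
  refine h ?_
  rw [pairCoeff]
  rcases h' with h' | h' <;> simp [h']

variable [Fintype ι]

/-- The residue at `z_j` of the Cartan part, applied to the pair `q`. -/
def pairResidue (ε : ι → ℤˣ) (k : ι → ℤ) (z : ι → ℂ) (q : Finset ι × Finset ι) (j : ι) :
    MvPowerSeries Par ℂ :=
  residueTerm (pairDiff (fun i => (ε i : ℤ)) q) (pairDiff k q) z j *
    evalSym (pairPhase ε k z q) expD

lemma sum_pairDiff_of_pairCoeff_ne_zero {ε : ι → ℤˣ} {a z : ι → ℂ} {m n : ℤ}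
    {q : Finset ι × Finset ι} (h : pairCoeff ε a z m n q ≠ 0) :
    ∑ i, pairDiff (fun i => (ε i : ℤ)) q i = m - n := by
  rw [sum_pairDiff, (eq_charge_of_pairCoeff_ne_zero h).1, (eq_charge_of_pairCoeff_ne_zero h).2]

lemma coeff_hirota_cartanPart (ε : ι → ℤˣ) (a : ι → ℂ) (k : ι → ℤ) {z : ι → ℂ}
    (hz : Function.Injective z) (m n : ℤ) (d : Par →₀ ℕ) :
    coeff d (hirota (cartanPart (m - n) * expD) (solitonSum ε a k z m) (solitonSum ε a k z n)) =
      ∑ j, ∑ q : Finset ι × Finset ι,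
        (pairCoeff ε a z m n q * (((pairDiff (fun i => (ε i : ℤ)) q j : ℤ) : ℂ) ^ 2 *
          coeff d (pairResidue ε k z q j))) • pairExp ε k z q := by
  rw [coeff_hirota_solitonSum, Finset.sum_comm]
  refine Finset.sum_congr rfl fun q _ => ?_
  rw [← Finset.sum_smul, ← Finset.mul_sum]
  by_cases h : pairCoeff ε a z m n q = 0
  · rw [h, zero_mul, zero_mul]
  · congr 2
    rw [map_mul, ← sum_pairDiff_of_pairCoeff_ne_zero h, pairPhase,
      evalSym_cartanPart_eq_sum_residues _ _ _ (pairDiff_eq ε q)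
        (fun i => pairDiff_eq_zero ε k) hz, Finset.sum_mul, map_sum]
    refine Finset.sum_congr rfl fun j _ => ?_
    rw [mul_assoc, coeff_C_mul]
    rfl

/-- The value at `z_j` of the factors with `i ≠ j` of `∏ (ζ - z_i)^{2 σ η_i}`. -/
def pairInteraction (ε : ι → ℤˣ) (z : ι → ℂ) (σ : ℤ) (q : Finset ι × Finset ι) (j : ι) : ℂ :=
  ∏ i ∈ Finset.univ.erase j, (z j - z i) ^ (2 * (σ * pairDiff (fun i => (ε i : ℤ)) q i))

lemma coeff_hirota_rootPart (ε : ι → ℤˣ) (a : ι → ℂ) (k : ι → ℤ) {z : ι → ℂ}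
    (hz : Function.Injective z) {σ : ℤ} (hσ : σ = 1 ∨ σ = -1) (m n : ℤ) (d : Par →₀ ℕ) :
    coeff d (hirota (rootPart σ (m - n) * expD) (solitonSum ε a k z (m - σ))
        (solitonSum ε a k z (n + σ))) =
      ∑ j, ∑ q : Finset ι × Finset ι,
        (if pairDiff (fun i => (ε i : ℤ)) q j = σ then
          pairCoeff ε a z (m - σ) (n + σ) (flipPair j q) *
            (pairInteraction ε z σ (flipPair j q) j * coeff d (pairResidue ε k z q j))
          else 0) • pairExp ε k z q := by
  have hroot : coeff d (hirota (rootPart σ (m - n) * expD) (solitonSum ε a k z (m - σ))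
        (solitonSum ε a k z (n + σ))) = ∑ j, ∑ q : Finset ι × Finset ι,
        (if pairDiff (fun i => (ε i : ℤ)) q j = -σ then
          pairCoeff ε a z (m - σ) (n + σ) q *
            (pairInteraction ε z σ q j * coeff d (pairResidue ε k z (flipPair j q) j))
          else 0) • pairExp ε k z q := by
    rw [coeff_hirota_solitonSum, Finset.sum_comm]
    refine Finset.sum_congr rfl fun q _ => ?_
    rw [← Finset.sum_smul]
    by_cases h : pairCoeff ε a z (m - σ) (n + σ) q = 0
    · simp [h]
    · have hp : m - n = ∑ i, pairDiff (fun i => (ε i : ℤ)) q i + 2 * σ := by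
        rw [sum_pairDiff_of_pairCoeff_ne_zero h]
        ring
      congr 1
      rw [map_mul, hp, pairPhase, evalSym_rootPart_eq_sum_residues (pairDiff_eq ε q) hz hσ,
        Finset.sum_mul, map_sum, Finset.mul_sum, Finset.sum_filter]
      refine Finset.sum_congr rfl fun j _ => ?_
      have hiff : σ * pairDiff (fun i => (ε i : ℤ)) q j = -1 ↔
          pairDiff (fun i => (ε i : ℤ)) q j = -σ := by
        rcases hσ with rfl | rfl <;> constructor <;> intro h <;> linarith
      rw [if_congr hiff rfl rfl]
      split_ifs with hj
      · rw [mul_assoc (C _), residueTerm_mul_evalSym_expD j hj (pairDiff_flipPair _ j q)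
          (pairDiff_flipPair k j q), coeff_C_mul]
        rfl
      · rfl
  -- Reindexing by `flipPair j` gathers the residues of one pair with the Cartan part.
  rw [hroot]
  refine Finset.sum_congr rfl fun j _ => ?_
  rw [← Equiv.sum_comp (flipPair j)]
  refine Finset.sum_congr rfl fun q _ => ?_
  rw [pairDiff_flipPair, if_pos rfl, if_congr neg_inj rfl rfl]
  split_ifs with h
  · have hq : flipPair j (flipPair j q) = q := by
      simp [flipPair_apply, symmDiff_symmDiff_cancel_right]
    have hne : pairDiff (fun i => (ε i : ℤ)) q j ≠ 0 := by
      rcases hσ with rfl | rfl <;> rw [h] <;> norm_num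
    have hexp : pairExp ε k z (flipPair j q) = pairExp ε k z q := by
      rw [pairExp, pairExp, sum_add_sum_flipPair _ hne]
    rw [hq, hexp]
  · rw [zero_smul, zero_smul]

lemma pairCoeff_add_flipPair (ε : ι → ℤˣ) (a : ι → ℂ) {z : ι → ℂ}
    (hz : Function.Injective z) (m n : ℤ) {σ : ℤ} (hσ : σ = 1 ∨ σ = -1)
    {q : Finset ι × Finset ι} {j : ι} (h : pairDiff (fun i => (ε i : ℤ)) q j = σ) :
    pairCoeff ε a z m n q + (-1) ^ (m - n) *
      (pairCoeff ε a z (m - σ) (n + σ) (flipPair j q) *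
        pairInteraction ε z σ (flipPair j q) j) = 0 := by
  have hne : pairDiff (fun i => (ε i : ℤ)) q j ≠ 0 := by
    rcases hσ with rfl | rfl <;> rw [h] <;> norm_num
  obtain ⟨h1, h2⟩ := charge_flipPair ε hne
  rw [pairCoeff, pairCoeff, h1, h2, h]
  simp only [sub_left_inj, add_left_inj]
  by_cases hm : m = charge ε q.1
  · by_cases hn : n = charge ε q.2
    · rw [if_pos hm, if_pos hn, if_pos hm, if_pos hn, hm, hn, pairInteraction, ← h]
      exact solitonCoeff_mul_add_flipPair ε a hz hne
    · simp [hn]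
  · simp [hm]

/-- For distinct parameters the residues at each `z_j` cancel between the three parts of the
system. -/
lemma bilinearSystem_solitonSum_of_injective (ε : ι → ℤˣ) (a : ι → ℂ) (k : ι → ℤ) {z : ι → ℂ}
    (hz : Function.Injective z) : BilinearSystem (solitonSum ε a k z) := by
  intro m n
  have hpos := fun d => coeff_hirota_rootPart ε a k hz (Or.inl rfl) m n d
  have hneg := fun d => coeff_hirota_rootPart ε a k hz (Or.inr rfl) m n d
  simp only [sub_neg_eq_add, ← sub_eq_add_neg] at hneg
  ext1 d
  rw [map_add, map_add, coeff_complex_smul, coeff_complex_smul, coeff_hirota_cartanPart ε a k hz,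
    hpos, hneg, map_zero, Finset.smul_sum, Finset.smul_sum, ← Finset.sum_add_distrib,
    ← Finset.sum_add_distrib]
  refine Finset.sum_eq_zero fun j _ => ?_
  rw [Finset.smul_sum, Finset.smul_sum, ← Finset.sum_add_distrib, ← Finset.sum_add_distrib]
  refine Finset.sum_eq_zero fun q _ => ?_
  rw [smul_smul, smul_smul, ← add_smul, ← add_smul]
  convert zero_smul ℂ (pairExp ε k z q) using 2
  rcases pairDiff_eq ε q j with h | h | h
  · have := pairCoeff_add_flipPair ε a hz m n (Or.inr rfl) h
    simp only [sub_neg_eq_add, ← sub_eq_add_neg] at this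
    rw [h, if_neg (by norm_num), if_pos rfl]
    push_cast
    linear_combination coeff d (pairResidue ε k z q j) * this
  · rw [h, if_neg (by norm_num), if_neg (by norm_num)]
    push_cast
    ring
  · have := pairCoeff_add_flipPair ε a hz m n (Or.inl rfl) h
    rw [h, if_pos rfl, if_neg (by norm_num)]
    push_cast
    linear_combination coeff d (pairResidue ε k z q j) * this

end System

/-! ### Coinciding parameters -/

lemma analyticAt_coeff_hirota_solitonSum {N : ℕ} (ε : Fin N → ℤˣ) (a : Fin N → ℂ) (k : Fin N → ℤ)
    (P : Sym) (m n : ℤ) (d : Par →₀ ℕ) (e : Var →₀ ℕ) {x : Fin N → ℂ} (hx : x ∈ admissible ε) :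
    AnalyticAt ℂ (fun z => coeff e (coeff d
      (hirota P (solitonSum ε a k z m) (solitonSum ε a k z n)))) x := by
  simp only [coeff_hirota_solitonSum, map_sum, coeff_smul]
  refine Finset.analyticAt_fun_sum _ fun q _ => AnalyticAt.mul (AnalyticAt.mul ?_ ?_) ?_
  · refine AnalyticAt.mul ?_ ?_
    · split_ifs
      · exact analyticAt_solitonCoeff ε a _ hx
      · exact analyticAt_const
    · split_ifs
      · exact analyticAt_solitonCoeff ε a _ hx
      · exact analyticAt_const
  · refine AnalyticAt.aeval_mvPolynomial (fun v => ?_) (coeff d P)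
    exact analyticAt_sum_phase _ _ Finset.univ v x
  · refine analyticAt_coeff_expLin (fun v => ?_) e
    exact (analyticAt_sum_phase _ _ q.1 v x).add (analyticAt_sum_phase _ _ q.2 v x)

/-- Every parameter vector is a limit of vectors with distinct entries. -/
lemma exists_tendsto_injective {N : ℕ} (x : Fin N → ℂ) :
    ∃ f : ℂ → Fin N → ℂ, Filter.Tendsto f (nhdsWithin 0 {0}ᶜ) (nhds x) ∧
      ∀ᶠ t in nhdsWithin 0 {0}ᶜ, Function.Injective (f t) := by
  refine ⟨fun t i => x i + t * (i : ℕ), ?_, ?_⟩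
  · have hc : Continuous fun (t : ℂ) (i : Fin N) => x i + t * (i : ℕ) := by fun_prop
    have := hc.tendsto 0
    simp only [zero_mul, add_zero] at this
    exact this.mono_left nhdsWithin_le_nhds
  · -- Two coordinates agree for at most one value of `t`.
    have hpair : ∀ i j : Fin N, i ≠ j → ∀ᶠ t in nhdsWithin (0 : ℂ) {0}ᶜ,
        x i + t * (i : ℕ) ≠ x j + t * (j : ℕ) := by
      intro i j hij
      have hd : ((i : ℕ) : ℂ) - (j : ℕ) ≠ 0 :=
        sub_ne_zero.2 fun h => hij (Fin.ext (Nat.cast_injective h))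
      have hfin : ({(x j - x i) / (((i : ℕ) : ℂ) - (j : ℕ))} \ {0} : Set ℂ).Finite :=
        (Set.finite_singleton _).sdiff
      have hnhds : ({(x j - x i) / (((i : ℕ) : ℂ) - (j : ℕ))} \ {0} : Set ℂ)ᶜ ∈ nhds (0 : ℂ) :=
        hfin.isClosed.isOpen_compl.mem_nhds fun h => h.2 rfl
      filter_upwards [mem_nhdsWithin_of_mem_nhds hnhds, self_mem_nhdsWithin] with t ht ht0 h
      refine ht ⟨?_, ht0⟩
      rw [Set.mem_singleton_iff, eq_div_iff hd]
      linear_combination h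
    have hall : ∀ᶠ t in nhdsWithin (0 : ℂ) {0}ᶜ, ∀ i j : Fin N, i ≠ j →
        x i + t * (i : ℕ) ≠ x j + t * (j : ℕ) := by
      simp only [Filter.eventually_all]
      exact hpair
    filter_upwards [hall] with t ht i j h
    by_contra hij
    exact ht i j hij h

lemma bilinearSystem_solitonSum {N : ℕ} (ε : Fin N → ℤˣ) (a : Fin N → ℂ) (k : Fin N → ℤ)
    {x : Fin N → ℂ} (hx : x ∈ admissible ε) : BilinearSystem (solitonSum ε a k x) := by
  intro m n
  ext1 d
  ext1 e
  obtain ⟨f, hf, hinj⟩ := exists_tendsto_injective x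
  have hcont : ContinuousAt (fun z => coeff e (coeff d
      (hirota (cartanPart (m - n) * expD) (solitonSum ε a k z m) (solitonSum ε a k z n) +
      ((-1 : ℂ) ^ (m - n)) • hirota (rootPart 1 (m - n) * expD) (solitonSum ε a k z (m - 1))
        (solitonSum ε a k z (n + 1)) +
      ((-1 : ℂ) ^ (m - n)) • hirota (rootPart (-1) (m - n) * expD) (solitonSum ε a k z (m + 1))
        (solitonSum ε a k z (n - 1))))) x := by
    simp only [map_add, coeff_complex_smul]
    refine ((analyticAt_coeff_hirota_solitonSum ε a k _ _ _ d e hx).add ?_ |>.add ?_).continuousAt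
    · exact analyticAt_const.mul (analyticAt_coeff_hirota_solitonSum ε a k _ _ _ d e hx)
    · exact analyticAt_const.mul (analyticAt_coeff_hirota_solitonSum ε a k _ _ _ d e hx)
  refine tendsto_nhds_unique (hcont.tendsto.comp hf) (tendsto_const_nhds.congr' ?_)
  filter_upwards [hinj] with t ht
  have h := bilinearSystem_solitonSum_of_injective ε a k ht m n
  exact (congrArg (fun F => coeff e (coeff d F)) h).symm

lemma RadiallyOrdered.mem_admissible {N : ℕ} {z : Fin N → ℂ} (hz : RadiallyOrdered z)
    (ε : Fin N → ℤˣ) : z ∈ admissible ε := by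
  refine ⟨hz.1, fun i j hij h => ?_⟩
  rcases lt_trichotomy i j with hlt | rfl | hlt
  · exact (hz.2 i j hlt).ne (congrArg _ h)
  · exact hij rfl
  · exact (hz.2 j i hlt).ne (congrArg _ h.symm)

end TwoToroidal

end

theorem mainTheorem4 (N : ℕ) (ε : Fin N → ℤˣ) (a : Fin N → ℂ) (k : Fin N → ℤ) :
    -- the literal product of operators, where it converges
    (∀ z : Fin N → ℂ, TwoToroidal.RadiallyOrdered z →
      TwoToroidal.SolitonConverges N ε a k z ∧
      TwoToroidal.BilinearSystem (TwoToroidal.solitonTau N ε a k z) ∧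
      ∀ σ : ℤˣ, (∀ i, ε i = σ) →
        TwoToroidal.solitonTau N ε a k z = TwoToroidal.closedForm σ a k z) ∧
    -- its analytic continuation in `z`, for all admissible parameters
    ∃ T : (Fin N → ℂ) → TwoToroidal.Fock,
      (∀ z : Fin N → ℂ, TwoToroidal.RadiallyOrdered z →
        T z = TwoToroidal.solitonTau N ε a k z) ∧
      (∀ (s : ℤ) (d : TwoToroidal.Var →₀ ℕ),
        AnalyticOnNhd ℂ (fun z => MvPowerSeries.coeff d (T z s)) (TwoToroidal.admissible ε)) ∧
      (∀ z ∈ TwoToroidal.admissible ε, TwoToroidal.BilinearSystem (T z)) ∧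
      ∀ σ : ℤˣ, (∀ i, ε i = σ) → ∀ z : Fin N → ℂ, (∀ i, z i ≠ 0) →
        T z = TwoToroidal.closedForm σ a k z := by
  refine ⟨fun z hz => ?_, TwoToroidal.solitonSum ε a k, fun z hz => ?_,
    TwoToroidal.analyticOnNhd_solitonSum ε a k,
    fun z hz => TwoToroidal.bilinearSystem_solitonSum ε a k hz,
    fun σ h z _ => TwoToroidal.solitonSum_eq_closedForm ε a k z σ h⟩
  · obtain ⟨hconv, hτ⟩ := TwoToroidal.solitonTau_eq_solitonSum N ε a k z hz
    rw [hτ]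
    exact ⟨hconv, TwoToroidal.bilinearSystem_solitonSum ε a k (hz.mem_admissible ε),
      fun σ h => TwoToroidal.solitonSum_eq_closedForm ε a k z σ h⟩
  · exact (TwoToroidal.solitonTau_eq_solitonSum N ε a k z hz).2.symm
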